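/- **Setting.** Let $m,n\ge 0$, $r=\min\{m,n\}$, let $\mathcal D$ be a probability distribution of a random variable $\xi$, let $f(\cdot\,;\xi):\mathbb R^{m\times n}\to\mathbb R$ be integrable in $\xi$, and let $f(W)=\mathbb E_{\xi\sim\mathcal D}[f(W;\xi)]$. Assume that $f^*=\inf_W f(W)>-\infty$. Write $\mathrm{vec}(W)\in\mathbb R^{mn}$ for the vectorization of $W$ and $f_v(\mathrm{vec}(W))=f(W)$. Denote by $\|\cdot\|_{\rm F}$ and $\|\cdot\|_*$ the Frobenius and the nuclear norm; the operator norm of a third-order tensor $H$ is $\|H\|_{\rm op}=\max_{\|u\|_2=\|v\|_2=\|w\|_2=1}|\sum_{i,j,k}H_{ijk}u_iv_jw_k|$. The SVD of a matrix $A$ of rank $k$ is the compact one, $A=USV^\top$, where $U\in\mathbb R^{m\times k}$ and $V\in\mathbb R^{n\times k}$ have orthonormal columns and $S\in\mathbb R^{k\times k}$ is diagonal with positive diagonal; then $UV^\top$ depends only on $A$. **Assumptions.** 1. (Third derivative.) $f$ is three times differentiable and $\|\nabla^3 f_v(w)\|_{\rm op}\le s$ for all $w\in\mathbb R^{mn}$.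 2. (Bounded variance.) For every $W$, $f(\cdot\,;\xi)$ is differentiable at $W$ for almost every $\xi$, and the gradient $\nabla f(W;\xi)$ in $W$ (assumed jointly measurable in $(W,\xi)$) satisfies $\mathbb E[\nabla f(W;\xi)]=\nabla f(W)$ and $\mathbb E\|\nabla f(W;\xi)-\nabla f(W)\|_{\rm F}^2\le\sigma^2$, where $\sigma\ge0$. **Algorithm (Muon).** Given a deterministic $W_0\in\mathbb R^{m\times n}$, $\eta>0$, $\beta\in[0,1)$, an integer $B\ge1$ and independent samples $\xi_{t,i}\sim\mathcal D$ ($t\ge 0$, $1\le i\le B$), put, for $t=0,1,\dots$, $$G_t=\frac1B\sum_{i=1}^B\nabla f(W_t;\xi_{t,i}),\qquad M_0=G_0,\quad M_t=\beta M_{t-1}+(1-\beta)G_t\ (t\ge1),$$ $$M_t=U_tS_tV_t^\top\ \text{(SVD)},\qquad W_{t+1}=W_t-\eta\,U_tV_t^\top .$$ **Curvature quantities.** Let $\nabla f(W_t)-\nabla f(W_{t+1})=U_{g,t}S_{g,t}V_{g,t}^\top$ be an SVD, and put $$J_t=\mathrm{vec}(U_tV_t^\top)^\top\nabla^2f_v(\mathrm{vec}(W_t))\,\mathrm{vec}(U_tV_t^\top),\qquad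 \hat J_t=\mathrm{vec}(U_{g,t}V_{g,t}^\top)^\top\nabla^2f_v(\mathrm{vec}(W_t))\,\mathrm{vec}(U_tV_t^\top).$$ For an integer $T\ge1$ let $J=\frac1T\sum_{t=0}^{T-1}J_t$, $\hat J=\frac1T\sum_{t=0}^{T-2}\hat J_t$ and $J^*=\max\{\mathbb E[\hat J],\mathbb E[J]\}$. **Theorem.** There is an absolute constant $C>0$ such that, in every such situation, with $\Delta=f(W_0)-f^*$, the random variables $\|\nabla f(W_t)\|_*$, $J_t$ and $\hat J_t$ are integrable for all $t\ge0$, and for every $T\ge1$ $$\frac1T\sum_{t=0}^{T-1}\mathbb E\big[\|\nabla f(W_t)\|_*\big]\le\frac{\Delta}{T\eta}+\frac{J^*\eta}{2}+\frac{2\sigma\sqrt{r(1-\beta)}}{\sqrt{(1+\beta)B}}+\frac{2\beta\sigma\sqrt r}{(1-\beta)T\sqrt B}+\frac{2\eta\beta J^*}{1-\beta}+C\,\frac{s\,r^{3/2}\eta^2}{1-\beta}.$$ -/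

import Mathlib

open MeasureTheory ProbabilityTheory

namespace Muon

/-- Real `m × n` matrices. -/
abbrev Mat (m n : ℕ) : Type := Matrix (Fin m) (Fin n) ℝ

/-- The Euclidean space `ℝ^{mn}`, its coordinates being indexed by the pairs (row, column). -/
abbrev Vec (m n : ℕ) : Type := EuclideanSpace ℝ (Fin m × Fin n)

/-- Vectorization of a matrix. -/
def vec {m n : ℕ} (A : Mat m n) : Vec m n := WithLp.toLp 2 (fun p => A p.1 p.2)

/-- The inverse of vectorization. -/
def unvec {m n : ℕ} (w : Vec m n) : Mat m n := Matrix.of (fun i j => w (i, j))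

theorem unvec_vec {m n : ℕ} (A : Mat m n) : unvec (vec A) = A := rfl

theorem vec_unvec {m n : ℕ} (w : Vec m n) : vec (unvec w) = w := rfl

/-- A function of a matrix variable, viewed as a function `f_v` on `ℝ^{mn}`. -/
def fv {m n : ℕ} (f : Mat m n → ℝ) : Vec m n → ℝ := fun w => f (unvec w)

/-- The Frobenius norm. -/
noncomputable def frobNorm {m n : ℕ} (A : Mat m n) : ℝ := √(∑ i, ∑ j, A i j ^ 2)

/-- The nuclear norm: the sum of the singular values. -/
noncomputable def nuclearNorm {m n : ℕ} (A : Mat m n) : ℝ :=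
  ∑ i ∈ Finset.range (min m n), (Matrix.toEuclideanLin A).singularValues i

/-- The gradient of a function of a matrix variable, as a matrix. -/
noncomputable def matGrad {m n : ℕ} (f : Mat m n → ℝ) (W : Mat m n) : Mat m n :=
  unvec (gradient (fv f) (vec W))

/-- The Hessian form `vec(A)ᵀ ∇²f_v(vec W) vec(A')`. -/
noncomputable def hessForm {m n : ℕ} (f : Mat m n → ℝ) (W A A' : Mat m n) : ℝ :=
  iteratedFDeriv ℝ 2 (fv f) (vec W) ![vec A, vec A']

/-- A compact singular value decomposition `A = U diag(s) Vᵀ` with `rank A` positive singular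
values. -/
structure CompactSVD {m n : ℕ} (A : Mat m n) where
  U : Matrix (Fin m) (Fin A.rank) ℝ
  s : Fin A.rank → ℝ
  V : Matrix (Fin n) (Fin A.rank) ℝ
  orthU : U.transpose * U = 1
  orthV : V.transpose * V = 1
  s_pos : ∀ i, 0 < s i
  eq_mul : A = U * Matrix.diagonal s * V.transpose

theorem CompactSVD.exists {m n : ℕ} (A : Mat m n) : Nonempty (CompactSVD A) := by
  classical
  have hH : (A.transpose * A).IsHermitian := Matrix.isHermitian_conjTranspose_mul_self A
  have hcard : Fintype.card {i // hH.eigenvalues i ≠ 0} = A.rank := by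
    rw [← hH.rank_eq_card_non_zero_eigs]; exact Matrix.rank_transpose_mul_self A
  let e : Fin A.rank ≃ {i // hH.eigenvalues i ≠ 0} :=
    (finCongr hcard.symm).trans (Fintype.equivFin _).symm
  have hps : (A.transpose * A).PosSemidef := Matrix.posSemidef_conjTranspose_mul_self A
  have hnn : ∀ i, 0 ≤ hH.eigenvalues i := hps.eigenvalues_nonneg
  let Q : Matrix (Fin n) (Fin n) ℝ := hH.eigenvectorUnitary
  have hQ1 : Q.transpose * Q = 1 := (Matrix.mem_unitaryGroup_iff').1 hH.eigenvectorUnitary.2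
  have hQ2 : Q * Q.transpose = 1 := (Matrix.mem_unitaryGroup_iff).1 hH.eigenvectorUnitary.2
  have hdiag : A.transpose * A = Q * Matrix.diagonal hH.eigenvalues * Q.transpose := by
    have h := hH.spectral_theorem
    rw [Unitary.conjStarAlgAut_apply] at h
    exact h
  have hAQ : (A * Q).transpose * (A * Q) = Matrix.diagonal hH.eigenvalues := by
    calc (A * Q).transpose * (A * Q) = Q.transpose * (A.transpose * A) * Q := by
          simp only [Matrix.transpose_mul, Matrix.mul_assoc]
      _ = Q.transpose * (Q * Matrix.diagonal hH.eigenvalues * Q.transpose) * Q := by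
          exact congrArg (fun X => Q.transpose * X * Q) hdiag
      _ = (Q.transpose * Q) * Matrix.diagonal hH.eigenvalues * (Q.transpose * Q) := by
          simp only [Matrix.mul_assoc]
      _ = Matrix.diagonal hH.eigenvalues := by rw [hQ1, Matrix.one_mul, Matrix.mul_one]
  have hAQent : ∀ i j, ∑ k, (A * Q) k i * (A * Q) k j
      = Matrix.diagonal hH.eigenvalues i j := by
    intro i j; rw [← hAQ, Matrix.mul_apply]; simp only [Matrix.transpose_apply]
  have hzero : ∀ i, hH.eigenvalues i = 0 → ∀ k, (A * Q) k i = 0 := by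
    intro i hi k
    have h := hAQent i i
    rw [Matrix.diagonal_apply_eq, hi,
      Finset.sum_eq_zero_iff_of_nonneg (fun k _ => mul_self_nonneg _)] at h
    exact mul_self_eq_zero.1 (h k (Finset.mem_univ k))
  have hpos : ∀ k, 0 < hH.eigenvalues (e k) := fun k =>
    lt_of_le_of_ne (hnn _) (Ne.symm (e k).2)
  refine ⟨⟨Matrix.of fun i k => (A * Q) i (e k) / √(hH.eigenvalues (e k)),
    fun k => √(hH.eigenvalues (e k)), Matrix.of fun j k => Q j (e k), ?_, ?_,
    fun k => Real.sqrt_pos.2 (hpos k), ?_⟩⟩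
  · ext k l
    have h := hAQent (e k) (e l)
    have hk := Real.sqrt_pos.2 (hpos k)
    have hl := Real.sqrt_pos.2 (hpos l)
    have : ((Matrix.of fun i k => (A * Q) i (e k) / √(hH.eigenvalues (e k))).transpose *
        (Matrix.of fun i k => (A * Q) i (e k) / √(hH.eigenvalues (e k)))) k l
        = (∑ i, (A * Q) i (e k) * (A * Q) i (e l)) /
          (√(hH.eigenvalues (e k)) * √(hH.eigenvalues (e l))) := by
      rw [Finset.sum_div, Matrix.mul_apply]
      refine Finset.sum_congr rfl fun i _ => ?_
      simp only [Matrix.transpose_apply, Matrix.of_apply]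
      rw [div_mul_div_comm]
    rw [this, h]
    by_cases hkl : k = l
    · subst hkl
      rw [Matrix.diagonal_apply_eq, Matrix.one_apply_eq, Real.mul_self_sqrt (hnn _),
        div_self (hpos k).ne']
    · rw [Matrix.diagonal_apply_ne _ (fun hc => hkl (e.injective (Subtype.ext hc))),
        Matrix.one_apply_ne hkl, zero_div]
  · ext k l
    have h : (Q.transpose * Q) (e k) (e l) = (1 : Matrix (Fin n) (Fin n) ℝ) (e k) (e l) := by
      rw [hQ1]
    rw [Matrix.mul_apply] at h ⊢
    simp only [Matrix.transpose_apply, Matrix.of_apply] at h ⊢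
    rw [h]
    by_cases hkl : k = l
    · subst hkl; simp
    · rw [Matrix.one_apply_ne (fun hc => hkl (e.injective (Subtype.ext hc))),
        Matrix.one_apply_ne hkl]
  · have h1 : A = A * Q * Q.transpose := by rw [Matrix.mul_assoc, hQ2, Matrix.mul_one]
    ext i j
    conv_lhs => rw [h1]
    rw [Matrix.mul_apply, Matrix.mul_apply]
    simp only [Matrix.mul_diagonal, Matrix.transpose_apply, Matrix.of_apply]
    have h2 : ∀ k, (A * Q) i (e k) / √(hH.eigenvalues (e k)) * √(hH.eigenvalues (e k)) * Q j (e k)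
        = (fun x : {i // hH.eigenvalues i ≠ 0} => (A * Q) i x * Q j x) (e k) := by
      intro k
      have hk := Real.sqrt_pos.2 (hpos k)
      simp only
      rw [div_mul_cancel₀ _ hk.ne']
    refine Eq.trans ?_ (Finset.sum_congr rfl (fun k _ => (h2 k).symm))
    rw [Equiv.sum_comp e (fun x : {i // hH.eigenvalues i ≠ 0} => (A * Q) i x * Q j x)]
    rw [← Finset.sum_subtype (Finset.univ.filter fun x => hH.eigenvalues x ≠ 0) (by simp)
        (fun x => (A * Q) i x * Q j x)]
    refine (Finset.sum_subset (Finset.filter_subset _ _) fun x _ hx => ?_).symm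
    have hx0 : hH.eigenvalues x = 0 := by simpa using hx
    rw [hzero x hx0 i, zero_mul]

/-- A singular value decomposition of `A` (the product `U Vᵀ` does not depend on the choice, see
`polarFactor_eq`). -/
noncomputable def svd {m n : ℕ} (A : Mat m n) : CompactSVD A :=
  Classical.choice (CompactSVD.exists A)

/-- The orthogonalization `U Vᵀ` of a matrix `A = U S Vᵀ`. -/
noncomputable def polarFactor {m n : ℕ} (A : Mat m n) : Mat m n :=
  (svd A).U * (svd A).V.transpose

theorem polarFactor_eq {m n : ℕ} {A : Mat m n} (D : CompactSVD A) :
    polarFactor A = D.U * D.V.transpose := by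
  unfold polarFactor
  generalize svd A = E
  obtain ⟨U', s', V', hU', hV', hs', hA'⟩ := E
  obtain ⟨U, s, V, hU, hV, hs, hA⟩ := D
  simp only
  set S := Matrix.diagonal s with hS
  set S' := Matrix.diagonal s' with hS'
  have key : U' * S' * V'.transpose = U * S * V.transpose := by rw [← hA', ← hA]
  have keyT : V' * S' * U'.transpose = V * S * U.transpose := by
    have h := congrArg Matrix.transpose key
    simpa [Matrix.transpose_mul, Matrix.mul_assoc, hS, hS'] using h
  have e1 : S' * (V'.transpose * V) = (U'.transpose * U) * S := by
    have h := congrArg (fun X => U'.transpose * X * V) key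
    simp only [Matrix.mul_assoc, hV, Matrix.mul_one] at h
    rw [← Matrix.mul_assoc, hU', Matrix.one_mul] at h
    simpa only [Matrix.mul_assoc] using h
  have e2 : S' * (U'.transpose * U) = (V'.transpose * V) * S := by
    have h := congrArg (fun X => V'.transpose * X * U) keyT
    simp only [Matrix.mul_assoc, hU, Matrix.mul_one] at h
    rw [← Matrix.mul_assoc, hV', Matrix.one_mul] at h
    simpa only [Matrix.mul_assoc] using h
  have f1 : U * S = U' * (S' * (V'.transpose * V)) := by
    have h := congrArg (fun X => X * V) key
    simp only [Matrix.mul_assoc, hV, Matrix.mul_one] at h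
    exact h.symm
  have f2 : V * S = V' * (S' * (U'.transpose * U)) := by
    have h := congrArg (fun X => X * U) keyT
    simp only [Matrix.mul_assoc, hU, Matrix.mul_one] at h
    exact h.symm
  set X := U'.transpose * U with hX
  set Y := V'.transpose * V with hY
  have ent1 : ∀ i j, s' i * Y i j = X i j * s j := fun i j => by
    have h := congrFun (congrFun e1 i) j
    simpa [hS, hS', Matrix.diagonal_mul, Matrix.mul_diagonal] using h
  have ent2 : ∀ i j, s' i * X i j = Y i j * s j := fun i j => by
    have h := congrFun (congrFun e2 i) j
    simpa [hS, hS', Matrix.diagonal_mul, Matrix.mul_diagonal] using h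
  have hXY : X = Y := by
    ext i j
    have h1 := ent1 i j
    have h2 := ent2 i j
    have h3 : (s' i + s j) * (X i j - Y i j) = 0 := by linear_combination h2 - h1
    have h4 : s' i + s j ≠ 0 := (add_pos (hs' i) (hs j)).ne'
    exact sub_eq_zero.1 ((mul_eq_zero.1 h3).resolve_left h4)
  have hSinv : S * Matrix.diagonal (fun i => (s i)⁻¹) = 1 := by
    rw [hS, Matrix.diagonal_mul_diagonal, ← Matrix.diagonal_one]
    congr 1; funext i; exact mul_inv_cancel₀ (hs i).ne'
  have hUX : U = U' * X := by
    have h := congrArg (fun Z => Z * Matrix.diagonal (fun i => (s i)⁻¹)) f1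
    simp only [e1] at h
    simpa only [Matrix.mul_assoc, hSinv, Matrix.mul_one] using h
  have hVX : V = V' * X := by
    have h := congrArg (fun Z => Z * Matrix.diagonal (fun i => (s i)⁻¹)) f2
    simp only [e2] at h
    rw [← hXY] at h
    simpa only [Matrix.mul_assoc, hSinv, Matrix.mul_one] using h
  have hXX : X.transpose * X = 1 := by
    have h := hU
    rw [hUX, Matrix.transpose_mul, Matrix.mul_assoc, ← Matrix.mul_assoc U'.transpose, hU',
      Matrix.one_mul] at h
    exact h
  have hXX' : X * X.transpose = 1 := mul_eq_one_comm.1 hXX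
  rw [hUX, hVX, Matrix.transpose_mul, Matrix.mul_assoc, ← Matrix.mul_assoc X, hXX',
    Matrix.one_mul]

/-- The objective `f(W) = E_ξ[F(W; ξ)]`. -/
noncomputable def objective {m n : ℕ} {Ξ : Type*} [MeasurableSpace Ξ] (F : Mat m n → Ξ → ℝ)
    (D : Measure Ξ) (W : Mat m n) : ℝ := ∫ x, F W x ∂D

/-- The stochastic gradient `∇F(W; x)`, taken in the matrix variable. -/
noncomputable def stochGrad {m n : ℕ} {Ξ : Type*} (F : Mat m n → Ξ → ℝ) (W : Mat m n) (x : Ξ) :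
    Mat m n := matGrad (fun W' => F W' x) W

/-- `f` is three times differentiable and the operator norm of the third derivative tensor of
`f_v` is at most `s` everywhere. -/
def ThirdDerivBounded {m n : ℕ} (f : Mat m n → ℝ) (s : ℝ) : Prop :=
  ContDiff ℝ 2 (fv f) ∧ Differentiable ℝ (iteratedFDeriv ℝ 2 (fv f)) ∧
    ∀ w : Vec m n, ‖iteratedFDeriv ℝ 3 (fv f) w‖ ≤ s

/-- The stochastic gradient is an unbiased estimator of the gradient of the objective, with
variance at most `σ ^ 2` in the Frobenius norm. -/
def BoundedVariance {m n : ℕ} {Ξ : Type*} [MeasurableSpace Ξ] (F : Mat m n → Ξ → ℝ)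
    (D : Measure Ξ) (σ : ℝ) : Prop :=
  ∀ W : Mat m n,
    (∀ᵐ x ∂D, DifferentiableAt ℝ (fv (fun W' => F W' x)) (vec W)) ∧
    Integrable (fun x => vec (stochGrad F W x)) D ∧
    ∫ x, vec (stochGrad F W x) ∂D = vec (matGrad (objective F D) W) ∧
    Integrable (fun x => frobNorm (stochGrad F W x - matGrad (objective F D) W) ^ 2) D ∧
    ∫ x, frobNorm (stochGrad F W x - matGrad (objective F D) W) ^ 2 ∂D ≤ σ ^ 2

/-- The batch gradient `G = (1/B) ∑ i, ∇F(W; x i)`. -/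
noncomputable def batchGrad {m n B : ℕ} {Ξ : Type*} (F : Mat m n → Ξ → ℝ) (W : Mat m n)
    (x : Fin B → Ξ) : Mat m n := (1 / (B : ℝ)) • ∑ i, stochGrad F W (x i)

/-- The pair `(W_t, M_t)` of iterate and momentum produced by Muon with constant learning rate `η`
and momentum parameter `β` from the initial point `W₀`, along the samples `x t i`. -/
noncomputable def muon {m n B : ℕ} {Ξ : Type*} (F : Mat m n → Ξ → ℝ) (W₀ : Mat m n) (η β : ℝ)
    (x : ℕ → Fin B → Ξ) : ℕ → Mat m n × Mat m n
  | 0 => (W₀, batchGrad F W₀ (x 0))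
  | t + 1 =>
    let W := (muon F W₀ η β x t).1
    let M := (muon F W₀ η β x t).2
    let W' := W - η • polarFactor M
    (W', β • M + (1 - β) • batchGrad F W' (x (t + 1)))

/-- `J_t`, for the sequence `X t = (W_t, M_t)`. -/
noncomputable def curvJ {m n : ℕ} (f : Mat m n → ℝ) (X : ℕ → Mat m n × Mat m n) (t : ℕ) : ℝ :=
  hessForm f (X t).1 (polarFactor (X t).2) (polarFactor (X t).2)

/-- `Ĵ_t`, for the sequence `X t = (W_t, M_t)`. -/
noncomputable def curvJhat {m n : ℕ} (f : Mat m n → ℝ) (X : ℕ → Mat m n × Mat m n) (t : ℕ) : ℝ :=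
  hessForm f (X t).1 (polarFactor (matGrad f (X t).1 - matGrad f (X (t + 1)).1))
    (polarFactor (X t).2)

/-- `J = (1/T) ∑_{t=0}^{T-1} J_t`. -/
noncomputable def avgJ {m n : ℕ} (f : Mat m n → ℝ) (X : ℕ → Mat m n × Mat m n) (T : ℕ) : ℝ :=
  1 / (T : ℝ) * ∑ t ∈ Finset.range T, curvJ f X t

/-- `Ĵ = (1/T) ∑_{t=0}^{T-2} Ĵ_t`. -/
noncomputable def avgJhat {m n : ℕ} (f : Mat m n → ℝ) (X : ℕ → Mat m n × Mat m n) (T : ℕ) : ℝ :=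
  1 / (T : ℝ) * ∑ t ∈ Finset.range (T - 1), curvJhat f X t

/-- `J* = max {E[Ĵ], E[J]}`, for a random sequence `X ω t = (W_t, M_t)`. -/
noncomputable def starJ {m n : ℕ} {Ω : Type*} [MeasurableSpace Ω] (P : Measure Ω)
    (f : Mat m n → ℝ) (X : Ω → ℕ → Mat m n × Mat m n) (T : ℕ) : ℝ :=
  max (∫ ω, avgJhat f (X ω) T ∂P) (∫ ω, avgJ f (X ω) T ∂P)

end Muon

/-! The argument is a bound along each sample path, followed by an expectation. Write `a t` for the
gradient at `w t` and `pol` for the map `A ↦ U Vᵀ`. A Taylor expansion along the step `-η • pol (M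
t)` bounds the decrease of the objective by `η ⟨a t, pol (M t)⟩`, up to the curvature term `η² J_t /
2` and a cubic remainder (`image_line_le`). Everything else rests on duality: `⟨A, pol A⟩` is the
nuclear norm of `A`, and `|⟨A, pol B⟩|` never exceeds it. Hence replacing `⟨a t, pol (M t)⟩` by the
nuclear norm of `a t` costs at most twice the nuclear norm of `M t - a t` (`nuc_le_inner_pol_add`).

This error splits into a gradient lag, an averaged noise and a decaying trace of the initial noise
(`momentum_eq`). The lag is a contraction driven by `a t - a (t + 1)`, whose nuclear norm is its
pairing with its own polar factor; to first order that pairing is `η Ĵ_t`, which is how `Ĵ` enters.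
Together these give `sum_nuc_gradient_le`.

For the noise, the nuclear norm is at most `√r` times the Frobenius norm, and samples are integrated
out one at a time against the past, giving second moment at most `(1 - β) / (1 + β) * σ² / B`
(`averagedNoise_bound`). Taking expectations requires `pol` to be measurable; it is a pointwise
limit of continuous Newton–Schulz iterates (`measurable_pol`). Integrability of the gradient and
curvature terms is automatic since the iterates stay in deterministic balls. -/

namespace LinearMap

/-- The singular values of `T` sum to the trace of the positive square root of `T* T`. -/
theorem sum_singularValues_eq_trace {E F : Type*} [NormedAddCommGroup E] [InnerProductSpace ℝ E]
    [FiniteDimensional ℝ E] [NormedAddCommGroup F] [InnerProductSpace ℝ F] [FiniteDimensional ℝ F]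
    (T : E →ₗ[ℝ] F) (H : E →ₗ[ℝ] E) (hsymm : H.IsSymmetric) (hpos : ∀ x, 0 ≤ inner ℝ (H x) x)
    (hsq : ∀ x, H (H x) = adjoint T (T x)) :
    ∑ i ∈ Finset.range (Module.finrank ℝ E), T.singularValues i = LinearMap.trace ℝ E H := by
  have hb (i : Fin (Module.finrank ℝ E)) :
      H (T.isSymmetric_adjoint_comp_self.eigenvectorBasis rfl i)
        = T.singularValues i • T.isSymmetric_adjoint_comp_self.eigenvectorBasis rfl i := by
    set v := T.isSymmetric_adjoint_comp_self.eigenvectorBasis rfl i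
    set c := T.singularValues i with hc
    have hc0 : 0 ≤ c := T.singularValues_nonneg i
    have hv : H (H v) = (c ^ 2) • v := by
      rw [hsq, hc, T.sq_singularValues_fin rfl i]
      exact T.isSymmetric_adjoint_comp_self.apply_eigenvectorBasis rfl i
    rcases hc0.eq_or_lt with h0 | h0
    · rw [← h0] at hv ⊢
      have : inner ℝ (H v) (H v) = 0 := by rw [hsymm]; simp [hv]
      simpa using inner_self_eq_zero.1 this
    -- Since `H² v = c² v`, the vector `H v - c v` is killed by `H + c`, which is positive definite
    -- for `c > 0`.
    · have hw : H (H v - c • v) + c • (H v - c • v) = 0 := by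
        rw [map_sub, map_smul, hv, smul_sub, smul_smul, pow_two]; abel
      have h1 : inner ℝ (H (H v - c • v)) (H v - c • v)
          + c * inner ℝ (H v - c • v) (H v - c • v) = 0 := by
        rw [← real_inner_smul_left, ← inner_add_left, hw, inner_zero_left]
      have h2 := hpos (H v - c • v)
      have h3 : inner ℝ (H v - c • v) (H v - c • v) = (0 : ℝ) := by
        have h4 : 0 ≤ inner ℝ (H v - c • v) (H v - c • v) := real_inner_self_nonneg
        nlinarith
      exact sub_eq_zero.1 (inner_self_eq_zero.1 h3)
  rw [LinearMap.trace_eq_sum_inner H (T.isSymmetric_adjoint_comp_self.eigenvectorBasis rfl),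
    Finset.sum_range]
  refine Finset.sum_congr rfl fun i _ => ?_
  rw [hb, real_inner_smul_right, real_inner_self_eq_norm_sq, OrthonormalBasis.norm_eq_one]
  simp

end LinearMap

namespace Muon

/-! ### Duality between the nuclear norm and the polar factor. -/

variable {m n : ℕ}

theorem inner_vec (A B : Mat m n) : inner ℝ (vec A) (vec B) = (A.transpose * B).trace := by
  simp only [vec, PiLp.inner_apply, Fintype.sum_prod_type, Matrix.trace, Matrix.diag,
    Matrix.mul_apply, Matrix.transpose_apply]
  rw [Finset.sum_comm]
  simp [mul_comm]

theorem CompactSVD.transpose_mul_self {A : Mat m n} (D : CompactSVD A) :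
    A.transpose * A = D.V * Matrix.diagonal D.s * D.V.transpose *
      (D.V * Matrix.diagonal D.s * D.V.transpose) := by
  conv_lhs => rw [D.eq_mul]
  simp only [Matrix.transpose_mul, Matrix.diagonal_transpose, Matrix.transpose_transpose]
  calc _ = D.V * (Matrix.diagonal D.s * (D.U.transpose * D.U)
        * (Matrix.diagonal D.s * D.V.transpose)) := by simp only [Matrix.mul_assoc]
    _ = D.V * (Matrix.diagonal D.s * (D.V.transpose * D.V)
        * (Matrix.diagonal D.s * D.V.transpose)) := by rw [D.orthU, D.orthV]
    _ = _ := by simp only [Matrix.mul_assoc]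

/-- The matrix `V S Vᵀ` is the positive semidefinite square root of `Aᵀ A`, and its trace is that of
`S`. -/
theorem nuclearNorm_eq_sum {A : Mat m n} (D : CompactSVD A) : nuclearNorm A = ∑ i, D.s i := by
  set T := Matrix.toEuclideanLin A with hT
  set K := D.V * Matrix.diagonal D.s * D.V.transpose with hK
  -- The trace formula sums over the dimension `n` of the domain; the extra singular values lie
  -- beyond the rank and vanish.
  have h1 : nuclearNorm A = ∑ i ∈ Finset.range n, T.singularValues i := by
    refine Finset.sum_subset (Finset.range_mono (min_le_right m n)) fun i _ hi => ?_
    rw [LinearMap.singularValues_eq_zero_iff_le_finrank_range]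
    have ha : Module.finrank ℝ T.range ≤ m := by
      simpa using Submodule.finrank_le T.range
    have hb : Module.finrank ℝ T.range ≤ n := by
      simpa using LinearMap.finrank_range_le T
    simp only [Finset.mem_range, not_lt] at hi
    exact (le_min ha hb).trans hi
  have hps : (Matrix.diagonal D.s).PosSemidef :=
    Matrix.PosSemidef.diagonal fun i => (D.s_pos i).le
  have hKpos : K.PosSemidef := by
    have := hps.mul_mul_conjTranspose_same D.V
    simpa [Matrix.conjTranspose_eq_transpose_of_trivial] using this
  have hKs : (Matrix.toEuclideanLin K).IsPositive := Matrix.isPositive_toEuclideanLin_iff.2 hKpos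
  have h2 := T.sum_singularValues_eq_trace (Matrix.toEuclideanLin K) hKs.1
    (fun x => by simpa using hKs.2 x) (fun x => by
      have hadj : LinearMap.adjoint T = Matrix.toEuclideanLin A.transpose := by
        rw [hT, ← Matrix.toEuclideanLin_conjTranspose_eq_adjoint,
          Matrix.conjTranspose_eq_transpose_of_trivial]
      rw [hadj, hT]
      apply (WithLp.ofLp_injective 2)
      simp only [Matrix.ofLp_toLpLin, Matrix.toLin'_apply, Matrix.mulVec_mulVec]
      rw [D.transpose_mul_self])
  rw [finrank_euclideanSpace_fin] at h2
  rw [h1, h2, Matrix.toEuclideanLin, Matrix.toLpLin_eq_toLin, Matrix.trace_toLin_eq, hK,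
    Matrix.trace_mul_comm,
    ← Matrix.mul_assoc, D.orthV, Matrix.one_mul, Matrix.trace_diagonal]

/-- Bessel's inequality: expand the squared length of `u - Q Qᵀ u`. -/
theorem bessel_transpose_mulVec {k l : ℕ} {Q : Matrix (Fin k) (Fin l) ℝ}
    (hQ : Q.transpose * Q = 1) (u : Fin k → ℝ) :
    (Q.transpose.mulVec u) ⬝ᵥ (Q.transpose.mulVec u) ≤ u ⬝ᵥ u := by
  set y := Q.transpose.mulVec u with hy
  have h1 : u ⬝ᵥ Q.mulVec y = y ⬝ᵥ y := by
    rw [Matrix.dotProduct_mulVec, hy, Matrix.mulVec_transpose]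
  have h2 : Q.mulVec y ⬝ᵥ Q.mulVec y = y ⬝ᵥ y := by
    rw [Matrix.dotProduct_mulVec, ← Matrix.mulVec_transpose, Matrix.mulVec_mulVec, hQ,
      Matrix.one_mulVec]
  have h3 : 0 ≤ (u - Q.mulVec y) ⬝ᵥ (u - Q.mulVec y) :=
    Finset.sum_nonneg fun i _ => mul_self_nonneg _
  rw [sub_dotProduct, dotProduct_sub, dotProduct_sub, h2, h1, dotProduct_comm (Q.mulVec y) u,
    h1] at h3
  linarith

theorem sum_sq_transpose_mul_le_one {k l p : ℕ} {Q : Matrix (Fin k) (Fin l) ℝ}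
    {R : Matrix (Fin k) (Fin p) ℝ} (hQ : Q.transpose * Q = 1) (hR : R.transpose * R = 1)
    (i : Fin p) : ∑ j, ((Q.transpose * R) j i) ^ 2 ≤ 1 := by
  have h := bessel_transpose_mulVec hQ (fun a => R a i)
  have h1 : (fun a => R a i) ⬝ᵥ (fun a => R a i) = 1 := by
    have := congrFun (congrFun hR i) i
    simpa [Matrix.mul_apply, dotProduct] using this
  rw [h1] at h
  refine le_trans (le_of_eq ?_) h
  simp only [dotProduct]
  exact Finset.sum_congr rfl fun j _ => pow_two _

theorem inner_vec_polarFactor_self (A : Mat m n) :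
    inner ℝ (vec A) (vec (polarFactor A)) = nuclearNorm A := by
  set D := svd A
  rw [inner_vec, nuclearNorm_eq_sum D, polarFactor_eq D]
  conv_lhs => enter [1, 1]; rw [D.eq_mul]
  simp only [Matrix.transpose_mul, Matrix.diagonal_transpose, Matrix.transpose_transpose]
  have : D.V * (Matrix.diagonal D.s * D.U.transpose) * (D.U * D.V.transpose)
      = D.V * (Matrix.diagonal D.s * (D.U.transpose * D.U)) * D.V.transpose := by
    simp only [Matrix.mul_assoc]
  rw [this, D.orthU, Matrix.mul_one, Matrix.trace_mul_comm, ← Matrix.mul_assoc, D.orthV,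
    Matrix.one_mul, Matrix.trace_diagonal]

/-- By cyclicity the pairing is a sum of the singular values of `A` weighted by the diagonal entries
of `(U_Aᵀ U_B)(V_Bᵀ V_A)`. Each such entry is a product of two vectors of length at most one by
Bessel, so it is at most one in absolute value. -/
theorem abs_inner_vec_polarFactor_le (A B : Mat m n) :
    |inner ℝ (vec A) (vec (polarFactor B))| ≤ nuclearNorm A := by
  set D := svd A
  set E := svd B
  rw [inner_vec, nuclearNorm_eq_sum D, polarFactor_eq E]
  conv_lhs => enter [1, 1, 1]; rw [D.eq_mul]
  simp only [Matrix.transpose_mul, Matrix.diagonal_transpose, Matrix.transpose_transpose]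
  have : D.V * (Matrix.diagonal D.s * D.U.transpose) * (E.U * E.V.transpose)
      = D.V * (Matrix.diagonal D.s * ((D.U.transpose * E.U) * E.V.transpose)) := by
    simp only [Matrix.mul_assoc]
  rw [this, Matrix.trace_mul_comm]
  have : (Matrix.diagonal D.s * ((D.U.transpose * E.U) * E.V.transpose)) * D.V
      = Matrix.diagonal D.s * ((D.U.transpose * E.U) * (E.V.transpose * D.V)) := by
    simp only [Matrix.mul_assoc]
  rw [this, Matrix.trace]
  refine (Finset.abs_sum_le_sum_abs _ _).trans (Finset.sum_le_sum fun i _ => ?_)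
  rw [Matrix.diag_apply, Matrix.diagonal_mul, abs_mul, abs_of_pos (D.s_pos i)]
  refine mul_le_of_le_one_right (D.s_pos i).le ?_
  have hX := sum_sq_transpose_mul_le_one E.orthU D.orthU i
  have hY := sum_sq_transpose_mul_le_one E.orthV D.orthV i
  rw [Matrix.mul_apply]
  refine (Finset.abs_sum_le_sum_abs _ _).trans ?_
  have hT : ∀ j, (D.U.transpose * E.U) i j = (E.U.transpose * D.U) j i := fun j => by
    simp [Matrix.mul_apply, mul_comm]
  have : ∑ j, |(D.U.transpose * E.U) i j * (E.V.transpose * D.V) j i|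
      ≤ ∑ j, (((E.U.transpose * D.U) j i) ^ 2 + ((E.V.transpose * D.V) j i) ^ 2) / 2 :=
    Finset.sum_le_sum fun j _ => by
      rw [hT, abs_mul, ← sq_abs ((E.U.transpose * D.U) j i), ← sq_abs ((E.V.transpose * D.V) j i)]
      linarith [two_mul_le_add_sq |(E.U.transpose * D.U) j i| |(E.V.transpose * D.V) j i|]
  rw [← Finset.sum_div, Finset.sum_add_distrib] at this
  linarith

/-- The squared Frobenius norm of `U Vᵀ` is exactly the rank. -/
theorem norm_vec_polarFactor_le (A : Mat m n) :
    ‖vec (polarFactor A)‖ ≤ √((min m n : ℕ) : ℝ) := by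
  refine Real.le_sqrt_of_sq_le ?_
  set D := svd A
  rw [← real_inner_self_eq_norm_sq, inner_vec, polarFactor_eq D, Matrix.transpose_mul,
    Matrix.transpose_transpose]
  have : D.V * D.U.transpose * (D.U * D.V.transpose)
      = D.V * (D.U.transpose * D.U) * D.V.transpose := by simp only [Matrix.mul_assoc]
  rw [this, D.orthU, Matrix.mul_one, Matrix.trace_mul_comm, D.orthV, Matrix.trace_one,
    Fintype.card_fin]
  exact_mod_cast le_min (by simpa using A.rank_le_card_height) (by simpa using A.rank_le_card_width)

/-- The nuclear norm on vectorized matrices. -/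
noncomputable def nuc (v : Vec m n) : ℝ := nuclearNorm (unvec v)

/-- The polar factor on vectorized matrices. -/
noncomputable def pol (v : Vec m n) : Vec m n := vec (polarFactor (unvec v))

theorem inner_pol_self (v : Vec m n) : inner ℝ v (pol v) = nuc v :=
  inner_vec_polarFactor_self (unvec v)

theorem inner_pol_le (v w : Vec m n) : inner ℝ v (pol w) ≤ nuc v :=
  (abs_le.1 (abs_inner_vec_polarFactor_le (unvec v) (unvec w))).2

theorem neg_nuc_le_inner_pol (v w : Vec m n) : -nuc v ≤ inner ℝ v (pol w) :=
  (abs_le.1 (abs_inner_vec_polarFactor_le (unvec v) (unvec w))).1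

theorem norm_pol_le (v : Vec m n) : ‖pol v‖ ≤ √((min m n : ℕ) : ℝ) :=
  norm_vec_polarFactor_le _

theorem nuc_nonneg (v : Vec m n) : 0 ≤ nuc v := by
  unfold nuc nuclearNorm
  exact Finset.sum_nonneg fun _ _ => LinearMap.singularValues_nonneg _ _

/-- Pair both summands with the polar factor of the sum and use duality. -/
theorem nuc_add_le (v w : Vec m n) : nuc (v + w) ≤ nuc v + nuc w := by
  rw [← inner_pol_self (v + w), inner_add_left]
  exact add_le_add (inner_pol_le _ _) (inner_pol_le _ _)

theorem nuc_smul_le {c : ℝ} (hc : 0 ≤ c) (v : Vec m n) : nuc (c • v) ≤ c * nuc v := by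
  rw [← inner_pol_self (c • v), real_inner_smul_left]
  exact mul_le_mul_of_nonneg_left (inner_pol_le _ _) hc

theorem nuc_le_norm (v : Vec m n) : nuc v ≤ √((min m n : ℕ) : ℝ) * ‖v‖ := by
  rw [← inner_pol_self v, mul_comm]
  exact (real_inner_le_norm _ _).trans (mul_le_mul_of_nonneg_left (norm_pol_le _) (norm_nonneg _))

/-! ### Measurability of the polar factor through Newton–Schulz iteration. -/

/-- One Newton–Schulz step for the polar factor. -/
noncomputable def newtonSchulz (A : Mat m n) : Mat m n :=
  (3 / 2 : ℝ) • A - (1 / 2 : ℝ) • (A * A.transpose * A)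

/-- The singular vectors are untouched, so the matrix iteration reduces to a scalar one on the
singular values. -/
theorem newtonSchulz_svd {k : ℕ} {U : Matrix (Fin m) (Fin k) ℝ} {V : Matrix (Fin n) (Fin k) ℝ}
    (hU : U.transpose * U = 1) (hV : V.transpose * V = 1) (a : Fin k → ℝ) :
    newtonSchulz (U * Matrix.diagonal a * V.transpose)
      = U * Matrix.diagonal (fun i => 3 / 2 * a i - 1 / 2 * a i ^ 3) * V.transpose := by
  have h : (U * Matrix.diagonal a * V.transpose) * (U * Matrix.diagonal a * V.transpose).transpose
        * (U * Matrix.diagonal a * V.transpose)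
      = U * Matrix.diagonal (fun i => a i ^ 3) * V.transpose := by
    simp only [Matrix.transpose_mul, Matrix.diagonal_transpose, Matrix.transpose_transpose]
    calc _ = U * (Matrix.diagonal a * (V.transpose * V) * (Matrix.diagonal a
          * (U.transpose * U) * Matrix.diagonal a)) * V.transpose := by
            simp only [Matrix.mul_assoc]
      _ = _ := by
        rw [hU, hV]
        simp only [Matrix.mul_one, Matrix.diagonal_mul_diagonal]
        congr 4
        funext i; ring
  have hsmul : ∀ (c : ℝ) (b : Fin k → ℝ), c • (U * Matrix.diagonal b * V.transpose)
      = U * Matrix.diagonal (c • b) * V.transpose := fun c b => by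
    rw [Matrix.diagonal_smul, Matrix.mul_smul, Matrix.smul_mul]
  rw [newtonSchulz, h, hsmul, hsmul, ← Matrix.sub_mul, ← Matrix.mul_sub, Matrix.diagonal_sub]
  rfl

theorem tendsto_newtonSchulz_scalar {x : ℝ} (hx0 : 0 < x) (hx1 : x ≤ 1) :
    Filter.Tendsto (fun k => (fun y : ℝ => 3 / 2 * y - 1 / 2 * y ^ 3)^[k] x) Filter.atTop
      (nhds 1) := by
  set p : ℝ → ℝ := fun y => 3 / 2 * y - 1 / 2 * y ^ 3 with hp
  have h : ∀ k, x ≤ p^[k] x ∧ p^[k] x ≤ 1 ∧ 1 - p^[k] x ≤ (1 - x / 2) ^ k := by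
    intro k
    induction k with
    | zero => simp [hx1, hx0.le]
    | succ k ih =>
      obtain ⟨h1, h2, h3⟩ := ih
      rw [Function.iterate_succ_apply']
      set y := p^[k] x
      have hy : 0 < y := hx0.trans_le h1
      -- The second factor equals `1 - y / 2 - y² / 2`. As the iterates never fall below `x`, it is
      -- at most `1 - x / 2`, a uniform contraction rate.
      have e : 1 - p y = (1 - y) * ((1 - y) * (2 + y) / 2) := by simp only [hp]; ring
      have e1 : 0 ≤ (1 - y) * (2 + y) / 2 := by
        have := mul_nonneg (sub_nonneg.2 h2) (by linarith : 0 ≤ 2 + y); linarith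
      have e2 : (1 - y) * (2 + y) / 2 ≤ 1 - x / 2 := by nlinarith
      refine ⟨h1.trans ?_, ?_, ?_⟩
      · simp only [hp]; nlinarith [mul_nonneg hy.le (sub_nonneg.2 h2), mul_pos hy hy]
      · have := mul_nonneg (sub_nonneg.2 h2) e1; linarith
      · rw [e, pow_succ]
        exact mul_le_mul h3 e2 e1 (by have : 0 ≤ 1 - x / 2 := by linarith
                                      positivity)
  have hlim : Filter.Tendsto (fun k : ℕ => 1 - (1 - x / 2) ^ k) Filter.atTop (nhds (1 - 0)) :=
    tendsto_const_nhds.sub (tendsto_pow_atTop_nhds_zero_of_lt_one (by linarith) (by linarith))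
  rw [sub_zero] at hlim
  exact tendsto_of_tendsto_of_tendsto_of_le_of_le hlim tendsto_const_nhds
    (fun k => by have := (h k).2.2; linarith) (fun k => (h k).2.1)

theorem continuous_newtonSchulz : Continuous (newtonSchulz : Mat m n → Mat m n) := by
  unfold newtonSchulz
  fun_prop

theorem continuous_vec : Continuous (vec : Mat m n → Vec m n) := by
  unfold vec
  fun_prop

theorem continuous_unvec : Continuous (unvec : Vec m n → Mat m n) := by
  refine continuous_matrix fun i j => ?_
  simp only [unvec, Matrix.of_apply]
  fun_prop

/-- Ensures that scaling by `(1 + ‖vec A‖)⁻¹` brings all singular values into `(0, 1]`, where the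
scalar iteration converges to `1`. -/
theorem CompactSVD.s_le_norm {A : Mat m n} (D : CompactSVD A) (i : Fin A.rank) :
    D.s i ≤ ‖vec A‖ := by
  refine le_of_sq_le_sq ?_ (norm_nonneg _)
  have h : ‖vec A‖ ^ 2 = ∑ j, D.s j ^ 2 := by
    rw [← real_inner_self_eq_norm_sq, inner_vec, D.transpose_mul_self]
    have : D.V * Matrix.diagonal D.s * D.V.transpose * (D.V * Matrix.diagonal D.s * D.V.transpose)
        = D.V * (Matrix.diagonal D.s * (D.V.transpose * D.V) * Matrix.diagonal D.s
          * D.V.transpose) := by simp only [Matrix.mul_assoc]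
    rw [this, Matrix.trace_mul_comm, Matrix.mul_assoc, D.orthV]
    simp only [Matrix.mul_one, Matrix.diagonal_mul_diagonal, Matrix.trace_diagonal, pow_two]
  rw [h]
  exact Finset.single_le_sum (f := fun j => D.s j ^ 2) (fun j _ => sq_nonneg _) (Finset.mem_univ i)

theorem tendsto_newtonSchulz_polarFactor (A : Mat m n) :
    Filter.Tendsto (fun k => newtonSchulz^[k] ((1 + ‖vec A‖)⁻¹ • A)) Filter.atTop
      (nhds (polarFactor A)) := by
  set D := svd A
  set c := (1 + ‖vec A‖)⁻¹ with hc
  have hc1 : 0 < 1 + ‖vec A‖ := by positivity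
  set p : ℝ → ℝ := fun y => 3 / 2 * y - 1 / 2 * y ^ 3 with hp
  have hk : ∀ k, newtonSchulz^[k] (c • A)
      = D.U * Matrix.diagonal (fun i => p^[k] (c * D.s i)) * D.V.transpose := by
    intro k
    induction k with
    | zero =>
      simp only [Function.iterate_zero, id_eq]
      conv_lhs => rw [D.eq_mul]
      rw [← Matrix.smul_mul, ← Matrix.mul_smul, ← Matrix.diagonal_smul]
      rfl
    | succ k ih =>
      rw [Function.iterate_succ_apply', ih, newtonSchulz_svd D.orthU D.orthV]
      simp only [Function.iterate_succ_apply']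
      rfl
  simp only [hk]
  rw [polarFactor_eq D]
  have hcont : Continuous fun a : Fin A.rank → ℝ => D.U * Matrix.diagonal a * D.V.transpose := by
    fun_prop
  have hlim : Filter.Tendsto (fun k => fun i => p^[k] (c * D.s i)) Filter.atTop
      (nhds (fun _ => (1 : ℝ))) := by
    refine tendsto_pi_nhds.2 fun i => tendsto_newtonSchulz_scalar ?_ ?_
    · exact mul_pos (inv_pos.2 hc1) (D.s_pos i)
    · rw [hc, inv_mul_le_iff₀ hc1]
      linarith [D.s_le_norm i]
  have := (hcont.tendsto (fun _ => (1 : ℝ))).comp hlim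
  simpa [Function.comp_def] using this

/-- The polar factor may jump where the rank changes, so continuity is not available; a pointwise
limit of continuous maps is enough. -/
theorem measurable_pol : Measurable (pol : Vec m n → Vec m n) := by
  refine measurable_of_tendsto_metrizable
    (f := fun k (v : Vec m n) => vec (newtonSchulz^[k] ((1 + ‖v‖)⁻¹ • unvec v)))
    (fun k => ?_) ?_
  · refine Continuous.measurable ?_
    refine continuous_vec.comp ((continuous_newtonSchulz.iterate k).comp ?_)
    refine Continuous.smul (Continuous.inv₀ (continuous_const.add continuous_norm) fun v => ?_)
      continuous_unvec
    exact (add_pos_of_pos_of_nonneg one_pos (norm_nonneg v)).ne'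
  · refine tendsto_pi_nhds.2 fun v => ?_
    exact (continuous_vec.tendsto _).comp (tendsto_newtonSchulz_polarFactor (unvec v))

theorem measurable_nuc : Measurable (nuc : Vec m n → ℝ) := by
  simp only [funext fun v : Vec m n => (inner_pol_self v).symm]
  exact measurable_id.inner measurable_pol

/-! ### Taylor estimates from a bounded third derivative. -/

section Calculus

variable {E : Type*} [NormedAddCommGroup E] [InnerProductSpace ℝ E]
  {φ : E → ℝ} {s : ℝ}

theorem inner_gradient_eq_fderiv [CompleteSpace E] (φ : E → ℝ) (w p : E) :
    inner ℝ (gradient φ w) p = fderiv ℝ φ w p := by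
  rw [← toDual_gradient, InnerProductSpace.toDual_apply_apply]

theorem norm_iteratedFDeriv_two_sub_le (hd : Differentiable ℝ (iteratedFDeriv ℝ 2 φ))
    (hs : ∀ w, ‖iteratedFDeriv ℝ 3 φ w‖ ≤ s) (w w' : E) :
    ‖iteratedFDeriv ℝ 2 φ w - iteratedFDeriv ℝ 2 φ w'‖ ≤ s * ‖w - w'‖ :=
  convex_univ.norm_image_sub_le_of_norm_fderiv_le (fun x _ => hd x)
    (fun x _ => (norm_fderiv_iteratedFDeriv (𝕜 := ℝ) (n := 2) (f := φ)).trans_le (hs x))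
    (Set.mem_univ w') (Set.mem_univ w)

theorem abs_iteratedFDeriv_two_sub_le (hd : Differentiable ℝ (iteratedFDeriv ℝ 2 φ))
    (hs : ∀ w, ‖iteratedFDeriv ℝ 3 φ w‖ ≤ s) (w w' p o : E) :
    |iteratedFDeriv ℝ 2 φ w ![p, o] - iteratedFDeriv ℝ 2 φ w' ![p, o]|
      ≤ s * ‖w - w'‖ * (‖p‖ * ‖o‖) := by
  have h := (iteratedFDeriv ℝ 2 φ w - iteratedFDeriv ℝ 2 φ w').le_opNorm ![p, o]
  simp only [sub_apply, Real.norm_eq_abs, Fin.prod_univ_two,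
    Matrix.cons_val_zero, Matrix.cons_val_one] at h
  exact h.trans (mul_le_mul_of_nonneg_right (norm_iteratedFDeriv_two_sub_le hd hs w w')
    (by positivity))

theorem hasDerivAt_fderiv_line (hc : ContDiff ℝ 2 φ) (w o p : E) (τ : ℝ) :
    HasDerivAt (fun τ : ℝ => fderiv ℝ φ (w - τ • o) p)
      (-iteratedFDeriv ℝ 2 φ (w - τ • o) ![p, o]) τ := by
  have h1 : HasDerivAt (fun τ : ℝ => w - τ • o) (-o) τ := by
    simpa using ((hasDerivAt_id τ).smul_const o).const_sub w
  have hd : Differentiable ℝ (fderiv ℝ φ) :=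
    (hc.fderiv_right (m := 1) (by norm_num)).differentiable (by norm_num)
  have h2 : HasDerivAt (fun τ : ℝ => fderiv ℝ φ (w - τ • o))
      (fderiv ℝ (fderiv ℝ φ) (w - τ • o) (-o)) τ :=
    (hd (w - τ • o)).hasFDerivAt.comp_hasDerivAt τ h1
  have h3 : HasDerivAt (fun τ : ℝ => fderiv ℝ φ (w - τ • o) p)
      (fderiv ℝ (fderiv ℝ φ) (w - τ • o) (-o) p) τ :=
    ((ContinuousLinearMap.apply ℝ ℝ p).hasFDerivAt.comp_hasDerivAt τ h2)
  have hsymm : IsSymmSndFDerivAt ℝ φ (w - τ • o) :=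
    hc.contDiffAt.isSymmSndFDerivAt (by simp)
  refine h3.congr_deriv ?_
  rw [iteratedFDeriv_two_apply, map_neg, neg_apply, hsymm.eq o p]
  rfl

/-- The mean value theorem writes the gradient difference as `η` times the Hessian at an
intermediate point, and the Hessian is `s`-Lipschitz. The sharp factor `1 / 2` is given up. -/
theorem abs_fderiv_sub_sub_le (hc : ContDiff ℝ 2 φ)
    (hd : Differentiable ℝ (iteratedFDeriv ℝ 2 φ))
    (hs : ∀ w, ‖iteratedFDeriv ℝ 3 φ w‖ ≤ s) (w o p : E) {η : ℝ} (hη : 0 < η) :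
    |fderiv ℝ φ w p - fderiv ℝ φ (w - η • o) p - η * iteratedFDeriv ℝ 2 φ w ![p, o]|
      ≤ s * η ^ 2 * ‖o‖ ^ 2 * ‖p‖ := by
  have hs0 : 0 ≤ s := (norm_nonneg _).trans (hs w)
  obtain ⟨c, ⟨hc0, hcη⟩, h⟩ := exists_hasDerivAt_eq_slope _ _ hη
    (fun τ _ => (hasDerivAt_fderiv_line hc w o p τ).continuousAt.continuousWithinAt)
    (fun τ _ => hasDerivAt_fderiv_line hc w o p τ)
  rw [eq_div_iff (by linarith)] at h
  simp only [zero_smul, sub_zero] at h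
  have e : fderiv ℝ φ w p - fderiv ℝ φ (w - η • o) p - η * iteratedFDeriv ℝ 2 φ w ![p, o]
      = η * (iteratedFDeriv ℝ 2 φ (w - c • o) ![p, o] - iteratedFDeriv ℝ 2 φ w ![p, o]) := by
    linear_combination h
  rw [e, abs_mul, abs_of_pos hη]
  calc _ ≤ η * (s * ‖(w - c • o) - w‖ * (‖p‖ * ‖o‖)) :=
        mul_le_mul_of_nonneg_left (abs_iteratedFDeriv_two_sub_le hd hs _ _ _ _) hη.le
    _ = c * (s * η * ‖o‖ ^ 2 * ‖p‖) := by
        rw [sub_sub_cancel_left, norm_neg, norm_smul, Real.norm_of_nonneg hc0.le]; ring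
    _ ≤ η * (s * η * ‖o‖ ^ 2 * ‖p‖) := mul_le_mul_of_nonneg_right hcη.le (by positivity)
    _ = _ := by ring

theorem image_line_le (hc : ContDiff ℝ 2 φ) (hd : Differentiable ℝ (iteratedFDeriv ℝ 2 φ))
    (hs : ∀ w, ‖iteratedFDeriv ℝ 3 φ w‖ ≤ s) (w o : E) {η : ℝ} (hη : 0 < η) :
    φ (w - η • o) ≤ φ w - η * fderiv ℝ φ w o + η ^ 2 / 2 * iteratedFDeriv ℝ 2 φ w ![o, o]
      + s * η ^ 3 * ‖o‖ ^ 3 := by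
  have hs0 : 0 ≤ s := (norm_nonneg _).trans (hs w)
  have hder : ∀ τ : ℝ, HasDerivAt (fun τ : ℝ => φ (w - τ • o) + τ * fderiv ℝ φ w o
        - τ ^ 2 / 2 * iteratedFDeriv ℝ 2 φ w ![o, o])
      (-fderiv ℝ φ (w - τ • o) o + fderiv ℝ φ w o - τ * iteratedFDeriv ℝ 2 φ w ![o, o]) τ := by
    intro τ
    have h1 : HasDerivAt (fun τ : ℝ => w - τ • o) (-o) τ := by
      simpa using ((hasDerivAt_id τ).smul_const o).const_sub w
    have hdφ : Differentiable ℝ φ := hc.differentiable (by norm_num)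
    have h2 : HasDerivAt (fun τ : ℝ => φ (w - τ • o)) (fderiv ℝ φ (w - τ • o) (-o)) τ :=
      (hdφ (w - τ • o)).hasFDerivAt.comp_hasDerivAt τ h1
    have h3 := (h2.add ((hasDerivAt_id τ).mul_const (fderiv ℝ φ w o))).sub
      ((((hasDerivAt_id τ).pow 2).div_const 2).mul_const (iteratedFDeriv ℝ 2 φ w ![o, o]))
    refine h3.congr_deriv ?_
    simp only [map_neg, id_eq, Nat.cast_ofNat]
    ring
  obtain ⟨c, ⟨hc0, hcη⟩, h⟩ := exists_hasDerivAt_eq_slope _ _ hη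
    (fun τ _ => (hder τ).continuousAt.continuousWithinAt) (fun τ _ => hder τ)
  rw [eq_div_iff (by linarith)] at h
  simp only [zero_smul, sub_zero] at h
  -- The derivative of the Taylor remainder at the intermediate time `c` is the gradient remainder
  -- for a step of length `c`.
  have hb := (abs_le.1 (abs_fderiv_sub_sub_le hc hd hs w o o hc0)).2
  have hcc : s * c ^ 2 * ‖o‖ ^ 2 * ‖o‖ ≤ s * η ^ 2 * ‖o‖ ^ 2 * ‖o‖ := by gcongr
  have := mul_le_mul_of_nonneg_left (hb.trans hcc) hη.le
  linarith

end Calculus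

/-- Nonnegativity of the variance of `‖y‖`. -/
theorem integral_norm_le_of_integral_sq_le {E Ω : Type*} [NormedAddCommGroup E]
    [MeasurableSpace Ω] {P : Measure Ω} [IsProbabilityMeasure P] {y : Ω → E}
    (hy : MemLp y 2 P) {K : ℝ} (hK : 0 ≤ K)
    (h : ∫ ω, ‖y ω‖ ^ 2 ∂P ≤ K ^ 2) : ∫ ω, ‖y ω‖ ∂P ≤ K := by
  have h1 := variance_eq_sub hy.norm
  have h2 := variance_nonneg (fun ω => ‖y ω‖) P
  rw [h1] at h2
  refine abs_le_of_sq_le_sq' ?_ hK |>.2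
  simp only [Pi.pow_apply] at h2
  linarith

theorem measurable_sum_noise {E G Ξ : Type*} [NormedAddCommGroup E] [MeasurableSpace E]
    [BorelSpace E] [SecondCountableTopology E] [MeasurableSpace Ξ] [MeasurableSpace G] {B : ℕ}
    {e : E × Ξ → E} (he : Measurable e)
    {w : G → E} {x : Fin B → G → Ξ} (hw : Measurable w) (S : Finset (Fin B))
    (hx : ∀ i ∈ S, Measurable (x i)) : Measurable fun g => ∑ i ∈ S, e (w g, x i g) :=
  Finset.measurable_fun_sum S fun i hi => he.comp (hw.prodMk (hx i hi))

/-! ### Sigma-algebras of past samples and independence. -/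

section SampleSigma

variable {Ω Ξ : Type*} [MeasurableSpace Ξ] {B : ℕ} {ξ : ℕ → Fin B → Ω → Ξ}

/-- The σ-algebra generated by the samples whose index lies in `S`. -/
@[reducible]
def sampleSigma (ξ : ℕ → Fin B → Ω → Ξ) (S : Set (ℕ × Fin B)) : MeasurableSpace Ω :=
  ⨆ p ∈ S, MeasurableSpace.comap (ξ p.1 p.2) inferInstance

theorem sampleSigma_mono {S T : Set (ℕ × Fin B)} (h : S ⊆ T) :
    sampleSigma ξ S ≤ sampleSigma ξ T :=
  biSup_mono h

theorem measurable_sampleSigma {S : Set (ℕ × Fin B)} {t : ℕ} {i : Fin B} (h : (t, i) ∈ S) :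
    Measurable[sampleSigma ξ S] (ξ t i) :=
  measurable_iff_comap_le.2
    (le_biSup (fun p : ℕ × Fin B => MeasurableSpace.comap (ξ p.1 p.2) inferInstance) h)

variable [MeasurableSpace Ω]

theorem sampleSigma_le (hξ : ∀ t i, Measurable (ξ t i)) (S : Set (ℕ × Fin B)) :
    sampleSigma ξ S ≤ ‹MeasurableSpace Ω› :=
  iSup₂_le fun p _ => (hξ p.1 p.2).comap_le

theorem indepFun_of_measurable_sampleSigma {P : Measure Ω} {G : Type*} [MeasurableSpace G]
    (hξ : ∀ t i, Measurable (ξ t i)) (hind : iIndepFun (fun p : ℕ × Fin B => ξ p.1 p.2) P)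
    {S : Set (ℕ × Fin B)} {Z : Ω → G} (hZ : Measurable[sampleSigma ξ S] Z) {t : ℕ} {i : Fin B}
    (h : (t, i) ∉ S) : IndepFun Z (ξ t i) P := by
  have h1 := indep_iSup_of_disjoint (fun p : ℕ × Fin B => (hξ p.1 p.2).comap_le) hind
    (Set.disjoint_singleton_right.2 h)
  rw [IndepFun_iff_Indep]
  refine indep_of_indep_of_le_left (indep_of_indep_of_le_right h1 ?_)
    (measurable_iff_comap_le.1 hZ)
  exact le_biSup (fun p : ℕ × Fin B => MeasurableSpace.comap (ξ p.1 p.2) inferInstance)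
    (Set.mem_singleton (t, i))

end SampleSigma

/-! ### Second moments of the mini-batch and momentum noise. -/

section Noise

variable {E Ω Ξ : Type*} [NormedAddCommGroup E] [InnerProductSpace ℝ E]
  [MeasurableSpace E] [BorelSpace E] [SecondCountableTopology E]
  [MeasurableSpace Ω] [MeasurableSpace Ξ]

/-- A jointly measurable family of centred random vectors with variance at most `σ ^ 2`. -/
structure IsCenteredNoise (e : E × Ξ → E) (D : Measure Ξ) (σ : ℝ) : Prop where
  measurable : Measurable e
  integrable : ∀ w, Integrable (fun x => e (w, x)) D
  integral_eq_zero : ∀ w, ∫ x, e (w, x) ∂D = 0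
  integrable_sq : ∀ w, Integrable (fun x => ‖e (w, x)‖ ^ 2) D
  integral_sq_le : ∀ w, ∫ x, ‖e (w, x)‖ ^ 2 ∂D ≤ σ ^ 2

variable [CompleteSpace E] {B : ℕ} {ξ : ℕ → Fin B → Ω → Ξ} {P : Measure Ω}
  [IsProbabilityMeasure P] {D : Measure Ξ} [IsProbabilityMeasure D] {σ : ℝ} {e : E × Ξ → E}

/-- Independence makes the joint law of `(y, w)` and `x` a product, so Fubini allows integrating
over `x` with `w` frozen. The cross term then vanishes because the noise is centred at every fixed
point. -/
theorem IsCenteredNoise.integral_norm_sq_add_le (he : IsCenteredNoise e D σ) {y w : Ω → E}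
    {x : Ω → Ξ} (hy : Measurable y) (hw : Measurable w) (hx : Measurable x) (hlaw : P.map x = D)
    (hind : IndepFun (fun ω => (y ω, w ω)) x P) (hy2 : MemLp y 2 P) (c : ℝ) :
    MemLp (fun ω => y ω + c • e (w ω, x ω)) 2 P ∧
      ∫ ω, ‖y ω + c • e (w ω, x ω)‖ ^ 2 ∂P ≤ ∫ ω, ‖y ω‖ ^ 2 ∂P + c ^ 2 * σ ^ 2 := by
  have hyw : Measurable fun ω => (y ω, w ω) := hy.prodMk hw
  set ν : Measure (E × E) := P.map fun ω => (y ω, w ω) with hν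
  have hνp : IsProbabilityMeasure ν := Measure.isProbabilityMeasure_map hyw.aemeasurable
  have hjoint : P.map (fun ω => ((y ω, w ω), x ω)) = ν.prod D := by
    rw [hind.map_prod_eq_prod_map_map hyw.aemeasurable hx.aemeasurable, hlaw]
  have hjm : Measurable fun ω => ((y ω, w ω), x ω) := hyw.prodMk hx
  have hem : Measurable fun p : (E × E) × Ξ => e (p.1.2, p.2) :=
    he.measurable.comp (by fun_prop)
  have hem2 : Measurable fun p : (E × E) × Ξ => ‖e (p.1.2, p.2)‖ ^ 2 := hem.norm.pow_const 2
  have hint2 : Integrable (fun p : (E × E) × Ξ => ‖e (p.1.2, p.2)‖ ^ 2) (ν.prod D) := by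
    rw [integrable_prod_iff hem2.aestronglyMeasurable]
    refine ⟨Filter.Eventually.of_forall fun z => he.integrable_sq z.2, ?_⟩
    refine Integrable.of_bound (C := σ ^ 2) ?_ (Filter.Eventually.of_forall fun z => ?_)
    · exact (hem2.norm.stronglyMeasurable.integral_prod_right').aestronglyMeasurable
    · rw [Real.norm_of_nonneg (integral_nonneg fun _ => norm_nonneg _)]
      simpa using he.integral_sq_le z.2
  have hval2 : ∫ ω, ‖e (w ω, x ω)‖ ^ 2 ∂P ≤ σ ^ 2 := by
    have h1 : ∫ ω, ‖e (w ω, x ω)‖ ^ 2 ∂P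
        = ∫ p, ‖e (p.1.2, p.2)‖ ^ 2 ∂(P.map fun ω => ((y ω, w ω), x ω)) :=
      (integral_map hjm.aemeasurable hem2.aestronglyMeasurable).symm
    rw [h1, hjoint, integral_prod _ hint2]
    calc _ ≤ ∫ _ : E × E, σ ^ 2 ∂ν :=
          integral_mono hint2.integral_prod_left (integrable_const _)
            fun z => he.integral_sq_le z.2
      _ = σ ^ 2 := by simp
  have hexm : Measurable fun ω => e (w ω, x ω) := he.measurable.comp (hw.prodMk hx)
  have heL : MemLp (fun ω => e (w ω, x ω)) 2 P := by
    rw [memLp_two_iff_integrable_sq_norm hexm.aestronglyMeasurable]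
    rw [← hjoint] at hint2
    exact hint2.comp_measurable hjm
  have hinner : Integrable (fun ω => inner ℝ (y ω) (e (w ω, x ω))) P := by
    refine Integrable.mono' (g := fun ω => ‖y ω‖ ^ 2 + ‖e (w ω, x ω)‖ ^ 2)
      (hy2.integrable_norm_pow (by norm_num) |>.add (heL.integrable_norm_pow (by norm_num)))
      (hy.inner hexm).aestronglyMeasurable (Filter.Eventually.of_forall fun ω => ?_)
    refine (norm_inner_le_norm _ _).trans ?_
    nlinarith [sq_nonneg (‖y ω‖ - ‖e (w ω, x ω)‖), sq_nonneg ‖y ω‖, sq_nonneg ‖e (w ω, x ω)‖]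
  have hcross : ∫ ω, inner ℝ (y ω) (e (w ω, x ω)) ∂P = 0 := by
    have him : Measurable fun p : (E × E) × Ξ => inner ℝ p.1.1 (e (p.1.2, p.2)) :=
      (by fun_prop : Measurable fun p : (E × E) × Ξ => p.1.1).inner hem
    have h1 : ∫ ω, inner ℝ (y ω) (e (w ω, x ω)) ∂P
        = ∫ p, inner ℝ p.1.1 (e (p.1.2, p.2)) ∂(P.map fun ω => ((y ω, w ω), x ω)) :=
      (integral_map hjm.aemeasurable him.aestronglyMeasurable).symm
    have h2 : Integrable (fun p : (E × E) × Ξ => inner ℝ p.1.1 (e (p.1.2, p.2))) (ν.prod D) := by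
      rw [← hjoint, integrable_map_measure him.aestronglyMeasurable hjm.aemeasurable]
      exact hinner
    rw [h1, hjoint, integral_prod _ h2]
    have h3 : ∀ z : E × E, ∫ v, inner ℝ z.1 (e (z.2, v)) ∂D = 0 := fun z => by
      rw [integral_inner (he.integrable z.2), he.integral_eq_zero, inner_zero_right]
    simp [h3]
  refine ⟨hy2.add (heL.const_smul c), ?_⟩
  have hexp : ∀ ω, ‖y ω + c • e (w ω, x ω)‖ ^ 2
      = ‖y ω‖ ^ 2 + 2 * c * inner ℝ (y ω) (e (w ω, x ω)) + c ^ 2 * ‖e (w ω, x ω)‖ ^ 2 := fun ω => by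
    rw [norm_add_sq_real, real_inner_smul_right, norm_smul, mul_pow, Real.norm_eq_abs, sq_abs]
    ring
  have i1 := hy2.integrable_norm_pow (p := 2) (by norm_num)
  have i2 := heL.integrable_norm_pow (p := 2) (by norm_num)
  simp only [hexp]
  have i3 : Integrable (fun ω => ‖y ω‖ ^ 2 + 2 * c * inner ℝ (y ω) (e (w ω, x ω))) P :=
    i1.add (hinner.const_mul _)
  rw [integral_add i3 (i2.const_mul _), integral_add i1 (hinner.const_mul _), integral_const_mul,
    integral_const_mul, hcross]
  nlinarith [mul_le_mul_of_nonneg_left hval2 (sq_nonneg c)]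

theorem IsCenteredNoise.integral_norm_sq_add_batch_le (he : IsCenteredNoise e D σ)
    (hξ : ∀ t i, Measurable (ξ t i)) (hlaw : ∀ t i, P.map (ξ t i) = D)
    (hind : iIndepFun (fun p : ℕ × Fin B => ξ p.1 p.2) P) {t : ℕ} {y w : Ω → E}
    (hy : Measurable[sampleSigma ξ {p | p.1 < t}] y)
    (hw : Measurable[sampleSigma ξ {p | p.1 < t}] w) (hy2 : MemLp y 2 P) (c : ℝ)
    (S : Finset (Fin B)) :
    MemLp (fun ω => y ω + c • ∑ i ∈ S, e (w ω, ξ t i ω)) 2 P ∧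
      ∫ ω, ‖y ω + c • ∑ i ∈ S, e (w ω, ξ t i ω)‖ ^ 2 ∂P
        ≤ ∫ ω, ‖y ω‖ ^ 2 ∂P + c ^ 2 * (S.card * σ ^ 2) := by
  classical
  induction S using Finset.induction_on with
  | empty => simpa using hy2
  | insert i S hi ih =>
    -- The partial batch sum belongs to the past of the next sample, so the past includes the
    -- samples of round `t` already used.
    set Q : Set (ℕ × Fin B) := {p | p.1 < t ∨ p.1 = t ∧ p.2 ∈ S} with hQ
    have hle : sampleSigma ξ {p | p.1 < t} ≤ sampleSigma ξ Q :=
      sampleSigma_mono fun p hp => Or.inl hp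
    have hyQ : Measurable[sampleSigma ξ Q] y := hy.mono hle le_rfl
    have hwQ : Measurable[sampleSigma ξ Q] w := hw.mono hle le_rfl
    have hsum : Measurable[sampleSigma ξ Q] fun ω => ∑ i ∈ S, e (w ω, ξ t i ω) :=
      @measurable_sum_noise E Ω Ξ _ _ _ _ _ (sampleSigma ξ Q) B e he.measurable w (ξ t) hwQ S
        fun j hj => measurable_sampleSigma (Or.inr ⟨rfl, hj⟩)
    have hyS : Measurable[sampleSigma ξ Q] fun ω => y ω + c • ∑ i ∈ S, e (w ω, ξ t i ω) :=
      hyQ.add (hsum.const_smul c)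
    have hni : (t, i) ∉ Q := by simp [hQ, hi]
    have hI := indepFun_of_measurable_sampleSigma hξ hind (hyS.prodMk hwQ) hni
    have hQle := sampleSigma_le hξ Q
    have key := he.integral_norm_sq_add_le (hyS.mono hQle le_rfl) (hwQ.mono hQle le_rfl) (hξ t i)
      (hlaw t i) hI ih.1 c
    have heq : ∀ ω, y ω + c • ∑ j ∈ insert i S, e (w ω, ξ t j ω)
        = y ω + c • ∑ j ∈ S, e (w ω, ξ t j ω) + c • e (w ω, ξ t i ω) := fun ω => by
      rw [Finset.sum_insert hi, smul_add]; abel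
    simp only [heq]
    refine ⟨key.1, key.2.trans ?_⟩
    rw [Finset.card_insert_of_notMem hi]
    push_cast
    linarith [ih.2]

/-- The exponentially averaged noise `y₀ = (1 - β) ε₀`, `yₜ₊₁ = β yₜ + (1 - β) εₜ₊₁`. -/
noncomputable def averagedNoise (β : ℝ) (ε : ℕ → E) : ℕ → E
  | 0 => (1 - β) • ε 0
  | t + 1 => β • averagedNoise β ε t + (1 - β) • ε (t + 1)

/-- The second moments obey `v ↦ β² v + (1 - β)² σ² / B`, whose fixed point is the stated bound. The
initial weight `1 - β` puts the start below it, since `(1 - β)² (1 + β) ≤ 1 - β`. -/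
theorem IsCenteredNoise.averagedNoise_bound (he : IsCenteredNoise e D σ)
    (hξ : ∀ t i, Measurable (ξ t i)) (hlaw : ∀ t i, P.map (ξ t i) = D)
    (hind : iIndepFun (fun p : ℕ × Fin B => ξ p.1 p.2) P) (hB : 1 ≤ B) {β : ℝ} (hβ0 : 0 ≤ β)
    (hβ1 : β < 1) {w : ℕ → Ω → E} (hw : ∀ t, Measurable[sampleSigma ξ {p | p.1 < t}] (w t))
    (t : ℕ) :
    Measurable[sampleSigma ξ {p | p.1 < t + 1}]
        (fun ω => averagedNoise β (fun t => (1 / (B : ℝ)) • ∑ i, e (w t ω, ξ t i ω)) t) ∧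
      MemLp (fun ω => averagedNoise β (fun t => (1 / (B : ℝ)) • ∑ i, e (w t ω, ξ t i ω)) t) 2 P ∧
      ∫ ω, ‖averagedNoise β (fun t => (1 / (B : ℝ)) • ∑ i, e (w t ω, ξ t i ω)) t‖ ^ 2 ∂P
        ≤ (1 - β) / (1 + β) * (σ ^ 2 / B) := by
  have hBpos : (0 : ℝ) < B := by exact_mod_cast hB
  have hsum : ∀ t, Measurable[sampleSigma ξ {p | p.1 < t + 1}]
      fun ω => (1 / (B : ℝ)) • ∑ i, e (w t ω, ξ t i ω) := fun t =>
    (@measurable_sum_noise E Ω Ξ _ _ _ _ _ (sampleSigma ξ {p | p.1 < t + 1}) B e he.measurable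
      (w t) (ξ t) ((hw t).mono (sampleSigma_mono fun p hp => Nat.lt_succ_of_lt hp) le_rfl) _
        fun j _ => measurable_sampleSigma (Nat.lt_succ_self t)).const_smul _
  have hc : ((1 - β) * (1 / (B : ℝ))) ^ 2 * ((Finset.univ : Finset (Fin B)).card * σ ^ 2)
      = (1 - β) ^ 2 * (σ ^ 2 / B) := by
    rw [Finset.card_univ, Fintype.card_fin]; field_simp
  have hσ : 0 ≤ σ ^ 2 / B := by positivity
  induction t with
  | zero =>
    have key := he.integral_norm_sq_add_batch_le (t := 0) hξ hlaw hind
      (measurable_const (a := (0 : E))) (hw 0) (MemLp.zero' (p := 2))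
      ((1 - β) * (1 / (B : ℝ))) Finset.univ
    rw [hc] at key
    simp only [zero_add, mul_smul, norm_zero, ne_eq, OfNat.ofNat_ne_zero, not_false_eq_true,
      zero_pow, integral_zero] at key
    refine ⟨(hsum 0).const_smul (1 - β), key.1, key.2.trans ?_⟩
    refine mul_le_mul_of_nonneg_right ?_ hσ
    rw [le_div_iff₀ (by linarith)]
    nlinarith [mul_nonneg hβ0 (mul_nonneg hβ0 (sub_nonneg.2 hβ1.le))]
  | succ t ih =>
    obtain ⟨ih1, ih2, ih3⟩ := ih
    have key := he.integral_norm_sq_add_batch_le hξ hlaw hind (t := t + 1)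
      (ih1.const_smul β) (hw (t + 1)) (ih2.const_smul β) ((1 - β) * (1 / (B : ℝ))) Finset.univ
    rw [hc] at key
    simp only [mul_smul] at key
    refine ⟨?_, key.1, key.2.trans ?_⟩
    · exact ((ih1.mono (sampleSigma_mono fun p hp => Nat.lt_succ_of_lt hp) le_rfl).const_smul
        β).add ((hsum (t + 1)).const_smul (1 - β))
    · simp only [Pi.smul_apply, norm_smul, mul_pow, Real.norm_eq_abs, sq_abs]
      rw [integral_const_mul]
      have h1 := mul_le_mul_of_nonneg_left ih3 (sq_nonneg β)
      have h2 : β ^ 2 * ((1 - β) / (1 + β) * (σ ^ 2 / B)) + (1 - β) ^ 2 * (σ ^ 2 / B)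
          = (1 - β) / (1 + β) * (σ ^ 2 / B) := by
        have : 1 + β ≠ 0 := by linarith
        field_simp
        ring
      linarith

end Noise

/-! ### The deterministic bound along one trajectory. -/

/-- A sequence driven by `x (t + 1) ≤ β (x t + δ t)` is summable in terms of `δ`. -/
theorem sum_le_of_contraction {β : ℝ} (hβ0 : 0 ≤ β) (hβ1 : β < 1) {x δ : ℕ → ℝ} (hx0 : x 0 ≤ 0)
    (hx : ∀ t, 0 ≤ x t) (hstep : ∀ t, x (t + 1) ≤ β * (x t + δ t)) (k : ℕ) :
    ∑ t ∈ Finset.range (k + 1), x t ≤ β / (1 - β) * ∑ t ∈ Finset.range k, δ t := by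
  have hc : 0 ≤ β / (1 - β) := div_nonneg hβ0 (by linarith)
  -- The extra term is a potential that pays for the later influence of `x k` and makes the
  -- induction close.
  have key : ∀ k, ∑ t ∈ Finset.range (k + 1), x t + β / (1 - β) * x k
      ≤ β / (1 - β) * ∑ t ∈ Finset.range k, δ t := by
    intro k
    induction k with
    | zero =>
      have : x 0 = 0 := le_antisymm hx0 (hx 0)
      simp [this]
    | succ k ih =>
      rw [Finset.sum_range_succ, Finset.sum_range_succ (fun t => δ t)]
      have h1 : x (k + 1) + β / (1 - β) * x (k + 1) ≤ β / (1 - β) * (x k + δ k) := by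
        have e : x (k + 1) + β / (1 - β) * x (k + 1) = x (k + 1) / (1 - β) := by
          have : 1 - β ≠ 0 := by linarith
          field_simp
          ring
        rw [e, div_mul_eq_mul_div]
        exact div_le_div_of_nonneg_right (hstep k) (by linarith)
      linarith
  linarith [key k, mul_nonneg hc (hx k)]

/-- The lag of the averaged gradient behind the current gradient: `z₀ = 0`,
`zₜ₊₁ = β (zₜ + aₜ - aₜ₊₁)`. -/
noncomputable def gradientLag {E : Type*} [AddCommGroup E] [Module ℝ E] (β : ℝ) (a : ℕ → E) : ℕ → E
  | 0 => 0
  | t + 1 => β • (gradientLag β a t + (a t - a (t + 1)))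

/-- Because `M 0 = g 0`, the initial noise has weight `β ^ t` in `M t`. The averaged noise accounts
for `(1 - β) β ^ t` of it, leaving `β ^ (t + 1)`. -/
theorem momentum_eq {E : Type*} [NormedAddCommGroup E] [InnerProductSpace ℝ E] {β : ℝ}
    {M g a : ℕ → E} (hM0 : M 0 = g 0) (hM : ∀ t, M (t + 1) = β • M t + (1 - β) • g (t + 1))
    (t : ℕ) :
    M t = a t + (gradientLag β a t + (averagedNoise β (fun t => g t - a t) t
      + β ^ (t + 1) • (g 0 - a 0))) := by
  induction t with
  | zero => simp only [hM0, gradientLag, averagedNoise]; module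
  | succ t ih => rw [hM, ih]; simp only [gradientLag, averagedNoise]; module

/-- One error `nuc (M - a)` arises in passing from `nuc a` to `nuc M`, a second in passing from `⟨M,
pol M⟩` to `⟨a, pol M⟩`. -/
theorem nuc_le_inner_pol_add (a M : Vec m n) :
    nuc a ≤ inner ℝ a (pol M) + 2 * nuc (M - a) := by
  have h1 : nuc a = inner ℝ M (pol a) - inner ℝ (M - a) (pol a) := by
    rw [← inner_sub_left, sub_sub_cancel, inner_pol_self]
  have h2 : nuc M = inner ℝ a (pol M) + inner ℝ (M - a) (pol M) := by
    rw [← inner_add_left, add_sub_cancel, inner_pol_self]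
  linarith [inner_pol_le M a, neg_nuc_le_inner_pol (M - a) a, inner_pol_le (M - a) M]

theorem sum_nuc_gradient_le {φ : Vec m n → ℝ} {s : ℝ} (hc : ContDiff ℝ 2 φ)
    (hd : Differentiable ℝ (iteratedFDeriv ℝ 2 φ)) (hs : ∀ w, ‖iteratedFDeriv ℝ 3 φ w‖ ≤ s)
    {η β : ℝ} (hη : 0 < η) (hβ0 : 0 ≤ β) (hβ1 : β < 1) {w M g : ℕ → Vec m n}
    (hw : ∀ t, w (t + 1) = w t - η • pol (M t)) (hM0 : M 0 = g 0)
    (hM : ∀ t, M (t + 1) = β • M t + (1 - β) • g (t + 1)) {T : ℕ} (hT : 1 ≤ T) :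
    ∑ t ∈ Finset.range T, nuc (gradient φ (w t))
      ≤ (φ (w 0) - φ (w T)) / η
        + η / 2 * ∑ t ∈ Finset.range T, iteratedFDeriv ℝ 2 φ (w t) ![pol (M t), pol (M t)]
        + 2 * (β / (1 - β)) * η * ∑ t ∈ Finset.range (T - 1), iteratedFDeriv ℝ 2 φ (w t)
            ![pol (gradient φ (w t) - gradient φ (w (t + 1))), pol (M t)]
        + 2 / (1 - β) * T * (s * √((min m n : ℕ) : ℝ) ^ 3 * η ^ 2)
        + 2 * √((min m n : ℕ) : ℝ) * ∑ t ∈ Finset.range T,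
            (‖averagedNoise β (fun t => g t - gradient φ (w t)) t‖
              + β ^ (t + 1) * ‖g 0 - gradient φ (w 0)‖) := by
  set r := √((min m n : ℕ) : ℝ) with hr
  have hr0 : 0 ≤ r := Real.sqrt_nonneg _
  have hs0 : 0 ≤ s := (norm_nonneg _).trans (hs 0)
  set a : ℕ → Vec m n := fun t => gradient φ (w t) with ha
  set N : ℕ → ℝ := fun t => ‖averagedNoise β (fun t => g t - a t) t‖ + β ^ (t + 1) * ‖g 0 - a 0‖
    with hN
  set J : ℕ → ℝ := fun t => iteratedFDeriv ℝ 2 φ (w t) ![pol (M t), pol (M t)] with hJ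
  set Jh : ℕ → ℝ := fun t => iteratedFDeriv ℝ 2 φ (w t) ![pol (a t - a (t + 1)), pol (M t)]
    with hJh
  have hdesc : ∀ t, nuc (a t) ≤ (φ (w t) - φ (w (t + 1))) / η + η / 2 * J t + s * r ^ 3 * η ^ 2
      + 2 * nuc (M t - a t) := by
    intro t
    have h1 := image_line_le hc hd hs (w t) (pol (M t)) hη
    rw [← hw, ← inner_gradient_eq_fderiv] at h1
    have h2 := nuc_le_inner_pol_add (a t) (M t)
    have h3 : s * η ^ 3 * ‖pol (M t)‖ ^ 3 ≤ s * η ^ 3 * r ^ 3 := by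
      gcongr
      exact norm_pol_le _
    have h4 : inner ℝ (a t) (pol (M t))
        ≤ (φ (w t) - φ (w (t + 1))) / η + η / 2 * J t + s * r ^ 3 * η ^ 2 := by
      refine le_of_mul_le_mul_left ?_ hη
      have e : η * ((φ (w t) - φ (w (t + 1))) / η + η / 2 * J t + s * r ^ 3 * η ^ 2)
          = φ (w t) - φ (w (t + 1)) + η ^ 2 / 2 * J t + s * η ^ 3 * r ^ 3 := by
        field_simp
      rw [e]
      simp only [ha, hJ]
      linarith
    linarith
  have hgap : ∀ t, nuc (M t - a t) ≤ nuc (gradientLag β a t) + r * N t := by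
    intro t
    rw [momentum_eq (a := a) hM0 hM t, add_sub_cancel_left]
    refine (nuc_add_le _ _).trans (add_le_add_right ?_ _)
    refine (nuc_le_norm _).trans (mul_le_mul_of_nonneg_left ((norm_add_le _ _).trans_eq ?_) hr0)
    rw [norm_smul, Real.norm_of_nonneg (pow_nonneg hβ0 _)]
  -- The gradient expansion is tested against the polar factor of the gradient difference itself,
  -- which turns the left side into a nuclear norm.
  have hδ : ∀ t, nuc (a t - a (t + 1)) ≤ η * Jh t + s * r ^ 3 * η ^ 2 := by
    intro t
    have h1 := (abs_le.1 (abs_fderiv_sub_sub_le hc hd hs (w t) (pol (M t))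
      (pol (a t - a (t + 1))) hη)).2
    rw [← hw, ← inner_gradient_eq_fderiv, ← inner_gradient_eq_fderiv, ← inner_sub_left] at h1
    have h2 : s * η ^ 2 * ‖pol (M t)‖ ^ 2 * ‖pol (a t - a (t + 1))‖ ≤ s * η ^ 2 * r ^ 2 * r := by
      gcongr
      · exact norm_pol_le _
      · exact norm_pol_le _
    have h3 := inner_pol_self (a t - a (t + 1))
    simp only [ha, hJh] at h1 h2 h3 ⊢
    linarith
  have hlag : ∑ t ∈ Finset.range T, nuc (gradientLag β a t)
      ≤ β / (1 - β) * ∑ t ∈ Finset.range (T - 1), nuc (a t - a (t + 1)) := by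
    have h := sum_le_of_contraction hβ0 hβ1 (x := fun t => nuc (gradientLag β a t))
      (δ := fun t => nuc (a t - a (t + 1))) ?_ (fun t => nuc_nonneg _) (fun t => ?_) (T - 1)
    · rwa [Nat.sub_add_cancel hT] at h
    · simpa [gradientLag] using nuc_le_norm (0 : Vec m n)
    · exact (nuc_smul_le hβ0 _).trans (mul_le_mul_of_nonneg_left (nuc_add_le _ _) hβ0)
  have hb : 0 < 1 - β := by linarith
  have hβb : 0 ≤ β / (1 - β) := div_nonneg hβ0 hb.le
  have hδsum : ∑ t ∈ Finset.range (T - 1), nuc (a t - a (t + 1))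
      ≤ η * ∑ t ∈ Finset.range (T - 1), Jh t + T * (s * r ^ 3 * η ^ 2) := by
    refine (Finset.sum_le_sum fun t _ => hδ t).trans ?_
    rw [Finset.sum_add_distrib, ← Finset.mul_sum, Finset.sum_const, Finset.card_range,
      nsmul_eq_mul]
    have : ((T - 1 : ℕ) : ℝ) ≤ T := by exact_mod_cast Nat.sub_le T 1
    gcongr
  have hsum := Finset.sum_le_sum fun t (_ : t ∈ Finset.range T) => hdesc t
  have hgapsum := Finset.sum_le_sum fun t (_ : t ∈ Finset.range T) => hgap t
  rw [Finset.sum_add_distrib, ← Finset.mul_sum] at hgapsum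
  rw [Finset.sum_add_distrib, Finset.sum_add_distrib, Finset.sum_add_distrib, ← Finset.sum_div,
    Finset.sum_range_sub', ← Finset.mul_sum, ← Finset.mul_sum, ← Finset.mul_sum,
    Finset.sum_const, Finset.card_range, nsmul_eq_mul] at hsum
  have hfin := mul_le_mul_of_nonneg_left hδsum hβb
  -- One remainder comes from the descent step and `2 β / (1 - β)` from the lag; together `(1 + β) /
  -- (1 - β) ≤ 2 / (1 - β)`, whence the absolute constant `2`.
  have hK : T * (s * r ^ 3 * η ^ 2) + 2 * (β / (1 - β) * (T * (s * r ^ 3 * η ^ 2)))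
      ≤ 2 / (1 - β) * T * (s * r ^ 3 * η ^ 2) := by
    have hX : 0 ≤ T * (s * r ^ 3 * η ^ 2) := by positivity
    have e : T * (s * r ^ 3 * η ^ 2) + 2 * (β / (1 - β) * (T * (s * r ^ 3 * η ^ 2)))
        = (1 + β) / (1 - β) * (T * (s * r ^ 3 * η ^ 2)) := by
      field_simp
      ring
    rw [e, mul_assoc (2 / (1 - β))]
    refine mul_le_mul_of_nonneg_right ?_ hX
    gcongr
    linarith
  change ∑ t ∈ Finset.range T, nuc (a t) ≤ (φ (w 0) - φ (w T)) / η
    + η / 2 * ∑ t ∈ Finset.range T, J t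
    + 2 * (β / (1 - β)) * η * ∑ t ∈ Finset.range (T - 1), Jh t
    + 2 / (1 - β) * T * (s * r ^ 3 * η ^ 2) + 2 * r * ∑ t ∈ Finset.range T, N t
  linarith

/-! ### Measurability and boundedness of the iterates. -/

theorem vec_batchGrad {B : ℕ} {Ξ : Type*} (F : Mat m n → Ξ → ℝ) (W : Mat m n) (x : Fin B → Ξ) :
    vec (batchGrad F W x) = (1 / (B : ℝ)) • ∑ i, vec (stochGrad F W (x i)) := by
  ext p
  simp [vec, batchGrad, Matrix.sum_apply]

theorem norm_vec (A : Mat m n) : ‖vec A‖ = frobNorm A := by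
  rw [EuclideanSpace.norm_eq, frobNorm, Fintype.sum_prod_type]
  simp [vec]

theorem measurable_vec_batchGrad {B : ℕ} {Ω Ξ : Type*} [MeasurableSpace Ω] [MeasurableSpace Ξ]
    {F : Mat m n → Ξ → ℝ}
    (hF : Measurable fun p : Vec m n × Ξ => vec (stochGrad F (unvec p.1) p.2))
    {W : Ω → Mat m n} (hW : Measurable fun ω => vec (W ω)) {x : Fin B → Ω → Ξ}
    (hx : ∀ i, Measurable (x i)) :
    Measurable fun ω => vec (batchGrad F (W ω) fun i => x i ω) := by
  simp only [vec_batchGrad]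
  exact (measurable_sum_noise (w := fun ω => vec (W ω)) hF hW Finset.univ
    fun i _ => hx i).const_smul (1 / (B : ℝ))

/-- Only the samples actually used are required to be measurable, so the lemma also applies with the
sigma-algebra of the past and yields adaptedness. -/
theorem measurable_muon {B : ℕ} {Ω Ξ : Type*} [MeasurableSpace Ω] [MeasurableSpace Ξ]
    {F : Mat m n → Ξ → ℝ}
    (hF : Measurable fun p : Vec m n × Ξ => vec (stochGrad F (unvec p.1) p.2))
    (W₀ : Mat m n) (η β : ℝ) (x : ℕ → Fin B → Ω → Ξ) (t : ℕ) :
    ((∀ τ < t, ∀ i, Measurable (x τ i)) →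
      Measurable fun ω => vec (muon F W₀ η β (fun t i => x t i ω) t).1) ∧
    ((∀ τ ≤ t, ∀ i, Measurable (x τ i)) →
      Measurable fun ω => vec (muon F W₀ η β (fun t i => x t i ω) t).2) := by
  induction t with
  | zero =>
    exact ⟨fun _ => measurable_const (a := vec W₀), fun hx =>
      measurable_vec_batchGrad hF (W := fun _ => W₀) measurable_const fun i => hx 0 le_rfl i⟩
  | succ t ih =>
    have h1 : (∀ τ < t + 1, ∀ i, Measurable (x τ i)) →
        Measurable fun ω => vec (muon F W₀ η β (fun t i => x t i ω) (t + 1)).1 := fun hx =>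
      (ih.1 fun τ hτ => hx τ (by omega)).sub
        ((measurable_pol.comp (ih.2 fun τ hτ => hx τ (by omega))).const_smul η)
    refine ⟨h1, fun hx => ?_⟩
    exact ((ih.2 fun τ hτ => hx τ (by omega)).const_smul β).add
      ((measurable_vec_batchGrad hF (h1 fun τ hτ => hx τ (by omega))
        fun i => hx (t + 1) le_rfl i).const_smul (1 - β))

theorem continuous_gradient {φ : Vec m n → ℝ} (hc : ContDiff ℝ 2 φ) : Continuous (gradient φ) := by
  have : Continuous (fderiv ℝ φ) := hc.continuous_fderiv (by norm_num)
  exact (InnerProductSpace.toDual ℝ (Vec m n)).symm.continuous.comp this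

theorem continuous_hessian_apply {φ : Vec m n → ℝ} (hc : ContDiff ℝ 2 φ) :
    Continuous fun q : Vec m n × Vec m n × Vec m n => iteratedFDeriv ℝ 2 φ q.1 ![q.2.1, q.2.2] := by
  have h : Continuous (fderiv ℝ (fderiv ℝ φ)) :=
    (hc.fderiv_right (m := 1) (by norm_num)).continuous_fderiv (by norm_num)
  simp only [iteratedFDeriv_two_apply]
  exact ((h.comp continuous_fst).clm_apply (continuous_fst.comp continuous_snd)).clm_apply
    (continuous_snd.comp continuous_snd)

/-- A measurable function of a random vector in a compact set, bounded there by a continuous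
function, is integrable. -/
theorem integrable_comp_of_mem_compact {Ω G : Type*} [MeasurableSpace Ω] {P : Measure Ω}
    [IsFiniteMeasure P] [TopologicalSpace G] [MeasurableSpace G] [OpensMeasurableSpace G]
    {K : Set G} (hK : IsCompact K) {ψ : G → ℝ} (hψ : Continuous ψ) {q : Ω → G} (hq : Measurable q)
    (hmem : ∀ ω, q ω ∈ K) : Integrable (fun ω => ψ (q ω)) P := by
  obtain ⟨C, hC⟩ := hK.exists_bound_of_continuousOn hψ.continuousOn
  exact Integrable.of_bound (hψ.measurable.comp hq).aestronglyMeasurable C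
    (Filter.Eventually.of_forall fun ω => hC _ (hmem ω))

/-- Every step has length at most `η √r` whatever the samples, so continuous functions of an iterate
are bounded. -/
theorem norm_vec_muon_sub_le {B : ℕ} {Ξ : Type*} (F : Mat m n → Ξ → ℝ) (W₀ : Mat m n) {η : ℝ}
    (hη : 0 ≤ η) (β : ℝ) (x : ℕ → Fin B → Ξ) (t : ℕ) :
    ‖vec (muon F W₀ η β x t).1 - vec W₀‖ ≤ t * (η * √((min m n : ℕ) : ℝ)) := by
  induction t with
  | zero => simp [muon]
  | succ t ih =>
    have e : vec (muon F W₀ η β x (t + 1)).1 - vec W₀ = (vec (muon F W₀ η β x t).1 - vec W₀)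
        - η • pol (vec (muon F W₀ η β x t).2) := by
      rw [sub_right_comm]; rfl
    have h : ‖η • pol (vec (muon F W₀ η β x t).2)‖ ≤ η * √((min m n : ℕ) : ℝ) := by
      rw [norm_smul, Real.norm_of_nonneg hη]
      exact mul_le_mul_of_nonneg_left (norm_pol_le _) hη
    rw [e]
    refine (norm_sub_le _ _).trans ((add_le_add ih h).trans_eq ?_)
    push_cast
    ring

theorem BoundedVariance.isCenteredNoise {Ξ : Type*} [MeasurableSpace Ξ] {F : Mat m n → Ξ → ℝ}
    {D : Measure Ξ} [IsProbabilityMeasure D] {σ : ℝ} (h : BoundedVariance F D σ)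
    (hF : Measurable fun p : Vec m n × Ξ => vec (stochGrad F (unvec p.1) p.2))
    (hc : ContDiff ℝ 2 (fv (objective F D))) :
    IsCenteredNoise (fun p : Vec m n × Ξ =>
      vec (stochGrad F (unvec p.1) p.2) - gradient (fv (objective F D)) p.1) D σ where
  measurable := hF.sub ((continuous_gradient hc).measurable.comp measurable_fst)
  integrable w := (h (unvec w)).2.1.sub
    (integrable_const (gradient (fv (objective F D)) w))
  integral_eq_zero w := by
    refine (integral_sub (h (unvec w)).2.1
      (integrable_const (gradient (fv (objective F D)) w))).trans ?_
    rw [(h (unvec w)).2.2.1, integral_const, probReal_univ, one_smul]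
    exact sub_self _
  integrable_sq w := by
    have := (h (unvec w)).2.2.2.1
    simp only [← norm_vec] at this
    exact this
  integral_sq_le w := by
    have := (h (unvec w)).2.2.2.2
    simp only [← norm_vec] at this
    exact this

theorem curvJ_eq (f : Mat m n → ℝ) (X : ℕ → Mat m n × Mat m n) (t : ℕ) :
    curvJ f X t = iteratedFDeriv ℝ 2 (fv f) (vec (X t).1)
      ![pol (vec (X t).2), pol (vec (X t).2)] := rfl

theorem curvJhat_eq (f : Mat m n → ℝ) (X : ℕ → Mat m n × Mat m n) (t : ℕ) :
    curvJhat f X t = iteratedFDeriv ℝ 2 (fv f) (vec (X t).1)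
      ![pol (gradient (fv f) (vec (X t).1) - gradient (fv f) (vec (X (t + 1)).1)),
        pol (vec (X t).2)] := rfl

end Muon

/-! ### Taking expectations. -/

theorem mainTheorem10 :
    ∃ C : ℝ, 0 < C ∧
    ∀ (m n : ℕ)
      -- the stochastic objective and its sampling distribution
      (Ξ : Type*) [MeasurableSpace Ξ] (D : Measure Ξ) [IsProbabilityMeasure D]
      (F : Muon.Mat m n → Ξ → ℝ) (s σ : ℝ),
      (∀ W, Integrable (F W) D) →
      Measurable (fun p : Muon.Vec m n × Ξ =>
        Muon.vec (Muon.stochGrad F (Muon.unvec p.1) p.2)) →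
      BddBelow (Set.range (Muon.objective F D)) →
      Muon.ThirdDerivBounded (Muon.objective F D) s →
      0 ≤ σ → Muon.BoundedVariance F D σ →
    -- the parameters of the algorithm
    ∀ (W₀ : Muon.Mat m n) (η β : ℝ) (B T : ℕ),
      0 < η → 0 ≤ β → β < 1 → 1 ≤ B → 1 ≤ T →
    -- the independent samples
    ∀ (Ω : Type*) [MeasurableSpace Ω] (P : Measure Ω) [IsProbabilityMeasure P]
      (ξ : ℕ → Fin B → Ω → Ξ),
      (∀ t i, Measurable (ξ t i)) →
      (∀ t i, P.map (ξ t i) = D) →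
      iIndepFun (fun p : ℕ × Fin B => ξ p.1 p.2) P →
    -- the run of the algorithm
    ∀ X : Ω → ℕ → Muon.Mat m n × Muon.Mat m n,
      (∀ ω, X ω = Muon.muon F W₀ η β (fun t i => ξ t i ω)) →
    (∀ t, Integrable (fun ω =>
        Muon.nuclearNorm (Muon.matGrad (Muon.objective F D) (X ω t).1)) P ∧
      Integrable (fun ω => Muon.curvJ (Muon.objective F D) (X ω) t) P ∧
      Integrable (fun ω => Muon.curvJhat (Muon.objective F D) (X ω) t) P) ∧
    1 / (T : ℝ) * ∑ t ∈ Finset.range T,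
        ∫ ω, Muon.nuclearNorm (Muon.matGrad (Muon.objective F D) (X ω t).1) ∂P
      ≤ (Muon.objective F D W₀ - ⨅ W, Muon.objective F D W) / (T * η)
        + Muon.starJ P (Muon.objective F D) X T * η / 2
        + 2 * σ * √((min m n : ℕ) * (1 - β)) / √((1 + β) * B)
        + 2 * β * σ * √((min m n : ℕ) : ℝ) / ((1 - β) * T * √(B : ℝ))
        + 2 * η * β * Muon.starJ P (Muon.objective F D) X T / (1 - β)
        + C * (s * ((min m n : ℕ) : ℝ) ^ (3 / 2 : ℝ) * η ^ 2 / (1 - β)) := by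
  refine ⟨2, by norm_num, ?_⟩
  intro m n Ξ _ D _ F s σ _hFint hF hbdd hthird hσ hvar W₀ η β B T hη hβ0 hβ1 hB hT Ω _ P _ ξ hξ
    hlaw hind X hX
  obtain ⟨hc, hd, hs⟩ := hthird
  obtain rfl : X = fun ω => Muon.muon F W₀ η β (fun t i => ξ t i ω) := funext hX
  set f := Muon.objective F D with hf
  set φ := Muon.fv f with hφ
  set r := √((min m n : ℕ) : ℝ) with hr
  have hr0 : 0 ≤ r := Real.sqrt_nonneg _
  have hs0 : 0 ≤ s := (norm_nonneg _).trans (hs 0)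
  set w : ℕ → Ω → Muon.Vec m n :=
    fun t ω => Muon.vec (Muon.muon F W₀ η β (fun t i => ξ t i ω) t).1 with hw
  set M : ℕ → Ω → Muon.Vec m n :=
    fun t ω => Muon.vec (Muon.muon F W₀ η β (fun t i => ξ t i ω) t).2 with hM
  set g : ℕ → Ω → Muon.Vec m n := fun t ω =>
    Muon.vec (Muon.batchGrad F (Muon.muon F W₀ η β (fun t i => ξ t i ω) t).1 fun i => ξ t i ω)
    with hg
  have hwm : ∀ t, Measurable (w t) := fun t =>
    (Muon.measurable_muon hF W₀ η β ξ t).1 fun τ _ i => hξ τ i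
  have hMm : ∀ t, Measurable (M t) := fun t =>
    (Muon.measurable_muon hF W₀ η β ξ t).2 fun τ _ i => hξ τ i
  have hwpast : ∀ t, Measurable[Muon.sampleSigma ξ {p | p.1 < t}] (w t) := fun t =>
    (@Muon.measurable_muon m n B Ω Ξ (Muon.sampleSigma ξ {p | p.1 < t}) _ F hF W₀ η β ξ t).1
      fun τ hτ i => Muon.measurable_sampleSigma hτ
  have hgrad := Muon.continuous_gradient hc
  have hball : ∀ (t : ℕ) ω, w t ω ∈ Metric.closedBall (Muon.vec W₀) (t * (η * r)) := fun t ω =>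
    mem_closedBall_iff_norm.2 (Muon.norm_vec_muon_sub_le F W₀ hη.le β _ t)
  have hpolball : ∀ v : Muon.Vec m n, Muon.pol v ∈ Metric.closedBall (0 : Muon.Vec m n) r :=
    fun v => mem_closedBall_zero_iff.2 (Muon.norm_pol_le v)
  have hInuc : ∀ t, Integrable (fun ω => Muon.nuc (gradient φ (w t ω))) P := fun t => by
    refine Integrable.mono' (g := fun ω => r * ‖gradient φ (w t ω)‖) ?_
      (Muon.measurable_nuc.comp (hgrad.measurable.comp (hwm t))).aestronglyMeasurable
      (Filter.Eventually.of_forall fun ω => ?_)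
    · exact Muon.integrable_comp_of_mem_compact (isCompact_closedBall _ _)
        (ψ := fun v => r * ‖gradient φ v‖) (continuous_const.mul hgrad.norm) (hwm t) (hball t)
    · rw [Real.norm_of_nonneg (Muon.nuc_nonneg _)]
      exact Muon.nuc_le_norm _
  have hIhess : ∀ t (v : Ω → Muon.Vec m n), Measurable v → Integrable (fun ω =>
      iteratedFDeriv ℝ 2 φ (w t ω) ![Muon.pol (v ω), Muon.pol (M t ω)]) P := fun t v hv =>
    Muon.integrable_comp_of_mem_compact
      (K := Metric.closedBall (Muon.vec W₀) (t * (η * r)) ×ˢ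
        (Metric.closedBall (0 : Muon.Vec m n) r ×ˢ Metric.closedBall (0 : Muon.Vec m n) r))
      ((isCompact_closedBall _ _).prod ((isCompact_closedBall _ _).prod (isCompact_closedBall _ _)))
      (Muon.continuous_hessian_apply hc)
      (q := fun ω => (w t ω, Muon.pol (v ω), Muon.pol (M t ω)))
      ((hwm t).prodMk ((Muon.measurable_pol.comp hv).prodMk (Muon.measurable_pol.comp (hMm t))))
      fun ω => ⟨hball t ω, hpolball _, hpolball _⟩
  have hIJ : ∀ t, Integrable (fun ω =>
      Muon.curvJ f (Muon.muon F W₀ η β (fun t i => ξ t i ω)) t) P := fun t => by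
    simp only [Muon.curvJ_eq]
    exact hIhess t (M t) (hMm t)
  have hIJh : ∀ t, Integrable (fun ω =>
      Muon.curvJhat f (Muon.muon F W₀ η β (fun t i => ξ t i ω)) t) P := fun t => by
    simp only [Muon.curvJhat_eq]
    exact hIhess t (fun ω => gradient φ (w t ω) - gradient φ (w (t + 1) ω))
      ((hgrad.measurable.comp (hwm t)).sub (hgrad.measurable.comp (hwm (t + 1))))
  refine ⟨fun t => ⟨hInuc t, hIJ t, hIJh t⟩, ?_⟩
  have hTpos : (0 : ℝ) < T := by exact_mod_cast hT
  have hBpos : (0 : ℝ) < B := by exact_mod_cast hB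
  have hb : 0 < 1 - β := by linarith
  have hb' : 0 < 1 + β := by linarith
  have hne := hvar.isCenteredNoise hF hc
  have hε : ∀ t ω, g t ω - gradient φ (w t ω) = (1 / (B : ℝ)) • ∑ i,
      (Muon.vec (Muon.stochGrad F (Muon.unvec (w t ω)) (ξ t i ω)) - gradient φ (w t ω)) := by
    intro t ω
    rw [Finset.sum_sub_distrib, smul_sub, hg]
    simp only [Muon.vec_batchGrad, Finset.sum_const, Finset.card_univ, Fintype.card_fin]
    rw [← Nat.cast_smul_eq_nsmul ℝ, smul_smul, one_div_mul_cancel hBpos.ne', one_smul]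
    rfl
  set N : ℕ → Ω → Muon.Vec m n := fun t ω =>
    Muon.averagedNoise β (fun t => g t ω - gradient φ (w t ω)) t with hN
  have hNb : ∀ t, MemLp (N t) 2 P ∧
      ∫ ω, ‖N t ω‖ ∂P ≤ √((1 - β) / (1 + β)) * (σ / √B) := fun t => by
    have h := (hne.averagedNoise_bound hξ hlaw hind hB hβ0 hβ1 hwpast t).2
    have e : N t = fun ω => Muon.averagedNoise β (fun t => (1 / (B : ℝ)) • ∑ i,
        (Muon.vec (Muon.stochGrad F (Muon.unvec (w t ω)) (ξ t i ω)) - gradient φ (w t ω))) t := by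
      funext ω
      simp only [hN, hε]
    rw [e]
    refine ⟨h.1, Muon.integral_norm_le_of_integral_sq_le h.1 (by positivity) (h.2.trans_eq ?_)⟩
    rw [mul_pow, div_pow, Real.sq_sqrt (div_nonneg hb.le hb'.le), Real.sq_sqrt hBpos.le]
  -- The initial noise enters with full weight, so its plain batch variance `σ² / B` is used.
  have hε0 : MemLp (fun ω => g 0 ω - gradient φ (w 0 ω)) 2 P ∧
      ∫ ω, ‖g 0 ω - gradient φ (w 0 ω)‖ ∂P ≤ σ / √B := by
    have h := hne.integral_norm_sq_add_batch_le (t := 0) hξ hlaw hind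
      (measurable_const (a := (0 : Muon.Vec m n))) (hwpast 0) (MemLp.zero' (p := 2))
      (1 / (B : ℝ)) Finset.univ
    simp only [zero_add, norm_zero, ne_eq, OfNat.ofNat_ne_zero, not_false_eq_true,
      zero_pow, integral_zero, Finset.card_univ, Fintype.card_fin] at h
    simp only [hε]
    refine ⟨h.1, Muon.integral_norm_le_of_integral_sq_le h.1 (by positivity) (h.2.trans_eq ?_)⟩
    rw [div_pow σ, Real.sq_sqrt hBpos.le]
    field_simp
  have hpath : ∀ ω, ∑ t ∈ Finset.range T, Muon.nuc (gradient φ (w t ω))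
      ≤ (f W₀ - ⨅ W, f W) / η
        + η / 2 * (T * Muon.avgJ f (Muon.muon F W₀ η β (fun t i => ξ t i ω)) T)
        + 2 * (β / (1 - β)) * η * (T * Muon.avgJhat f (Muon.muon F W₀ η β (fun t i => ξ t i ω)) T)
        + 2 / (1 - β) * T * (s * r ^ 3 * η ^ 2)
        + 2 * r * ∑ t ∈ Finset.range T,
            (‖N t ω‖ + β ^ (t + 1) * ‖g 0 ω - gradient φ (w 0 ω)‖) := by
    intro ω
    have h := Muon.sum_nuc_gradient_le hc hd hs hη hβ0 hβ1 (w := fun t => w t ω)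
      (M := fun t => M t ω) (g := fun t => g t ω) (fun _ => rfl) rfl (fun _ => rfl) hT
    have h1 : (φ (w 0 ω) - φ (w T ω)) / η ≤ (f W₀ - ⨅ W, f W) / η := by
      refine div_le_div_of_nonneg_right (sub_le_sub le_rfl ?_) hη.le
      exact ciInf_le hbdd (Muon.unvec (w T ω))
    have e1 : T * Muon.avgJ f (Muon.muon F W₀ η β (fun t i => ξ t i ω)) T
        = ∑ t ∈ Finset.range T, iteratedFDeriv ℝ 2 φ (w t ω)
            ![Muon.pol (M t ω), Muon.pol (M t ω)] := by
      rw [Muon.avgJ, ← mul_assoc, mul_one_div_cancel hTpos.ne', one_mul]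
      exact Finset.sum_congr rfl fun t _ => Muon.curvJ_eq _ _ _
    have e2 : T * Muon.avgJhat f (Muon.muon F W₀ η β (fun t i => ξ t i ω)) T
        = ∑ t ∈ Finset.range (T - 1), iteratedFDeriv ℝ 2 φ (w t ω)
            ![Muon.pol (gradient φ (w t ω) - gradient φ (w (t + 1) ω)), Muon.pol (M t ω)] := by
      rw [Muon.avgJhat, ← mul_assoc, mul_one_div_cancel hTpos.ne', one_mul]
      exact Finset.sum_congr rfl fun t _ => Muon.curvJhat_eq _ _ _
    rw [e1, e2]
    linarith
  have hIavgJ : Integrable (fun ω =>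
      Muon.avgJ f (Muon.muon F W₀ η β (fun t i => ξ t i ω)) T) P :=
    (integrable_finsetSum _ fun t _ => hIJ t).const_mul _
  have hIavgJh : Integrable (fun ω =>
      Muon.avgJhat f (Muon.muon F W₀ η β (fun t i => ξ t i ω)) T) P :=
    (integrable_finsetSum _ fun t _ => hIJh t).const_mul _
  have hIN : ∀ t, Integrable (fun ω => ‖N t ω‖) P := fun t =>
    ((hNb t).1.integrable (by norm_num)).norm
  have hIε : Integrable (fun ω => ‖g 0 ω - gradient φ (w 0 ω)‖) P :=
    (hε0.1.integrable (by norm_num)).norm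
  have hIns : ∀ t, Integrable (fun ω =>
      ‖N t ω‖ + β ^ (t + 1) * ‖g 0 ω - gradient φ (w 0 ω)‖) P := fun t =>
    (hIN t).add (hIε.const_mul _)
  have hInsum : Integrable (fun ω => ∑ t ∈ Finset.range T,
      (‖N t ω‖ + β ^ (t + 1) * ‖g 0 ω - gradient φ (w 0 ω)‖)) P :=
    integrable_finsetSum _ fun t _ => hIns t
  have hnoise : ∫ ω, ∑ t ∈ Finset.range T,
      (‖N t ω‖ + β ^ (t + 1) * ‖g 0 ω - gradient φ (w 0 ω)‖) ∂P
      ≤ T * (√((1 - β) / (1 + β)) * (σ / √B)) + β / (1 - β) * (σ / √B) := by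
    rw [integral_finsetSum _ fun t _ => hIns t]
    have hK : 0 ≤ σ / √(B : ℝ) := by positivity
    have h1 : ∀ t ∈ Finset.range T,
        ∫ ω, (‖N t ω‖ + β ^ (t + 1) * ‖g 0 ω - gradient φ (w 0 ω)‖) ∂P
        ≤ √((1 - β) / (1 + β)) * (σ / √B) + β ^ (t + 1) * (σ / √B) := fun t _ => by
      rw [integral_add (hIN t) (hIε.const_mul _), integral_const_mul]
      exact add_le_add (hNb t).2 (mul_le_mul_of_nonneg_left hε0.2 (pow_nonneg hβ0 _))
    refine (Finset.sum_le_sum h1).trans ?_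
    rw [Finset.sum_add_distrib, Finset.sum_const, Finset.card_range, nsmul_eq_mul,
      ← Finset.sum_mul]
    refine add_le_add le_rfl (mul_le_mul_of_nonneg_right ?_ hK)
    -- The weights `β ^ (t + 1)` form a geometric sum of at most `β / (1 - β)`, giving the noise
    -- term that decays like `1 / T`.
    simp only [pow_succ]
    rw [← Finset.sum_mul, geom_sum_eq hβ1.ne, ← neg_div_neg_eq, neg_sub, neg_sub,
      div_mul_eq_mul_div]
    refine div_le_div_of_nonneg_right ?_ hb.le
    nlinarith [pow_nonneg hβ0 T]
  have hint := integral_mono (integrable_finsetSum _ fun t _ => hInuc t)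
    (((((integrable_const ((f W₀ - ⨅ W, f W) / η)).add
      ((hIavgJ.const_mul (T : ℝ)).const_mul (η / 2))).add
      ((hIavgJh.const_mul (T : ℝ)).const_mul (2 * (β / (1 - β)) * η))).add
      (integrable_const (2 / (1 - β) * T * (s * r ^ 3 * η ^ 2)))).add
      (hInsum.const_mul (2 * r))) hpath
  rw [integral_finsetSum _ fun t _ => hInuc t,
    integral_add' ((((integrable_const ((f W₀ - ⨅ W, f W) / η)).add
      ((hIavgJ.const_mul (T : ℝ)).const_mul (η / 2))).add
      ((hIavgJh.const_mul (T : ℝ)).const_mul (2 * (β / (1 - β)) * η))).add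
      (integrable_const (2 / (1 - β) * T * (s * r ^ 3 * η ^ 2)))) (hInsum.const_mul (2 * r)),
    integral_add' (((integrable_const ((f W₀ - ⨅ W, f W) / η)).add
      ((hIavgJ.const_mul (T : ℝ)).const_mul (η / 2))).add
      ((hIavgJh.const_mul (T : ℝ)).const_mul (2 * (β / (1 - β)) * η)))
      (integrable_const (2 / (1 - β) * T * (s * r ^ 3 * η ^ 2))),
    integral_add' ((integrable_const ((f W₀ - ⨅ W, f W) / η)).add
      ((hIavgJ.const_mul (T : ℝ)).const_mul (η / 2)))
      ((hIavgJh.const_mul (T : ℝ)).const_mul (2 * (β / (1 - β)) * η)),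
    integral_add' (integrable_const ((f W₀ - ⨅ W, f W) / η))
      ((hIavgJ.const_mul (T : ℝ)).const_mul (η / 2))] at hint
  simp only [integral_const_mul, integral_const, probReal_univ, one_smul] at hint
  set Js := Muon.starJ P f (fun ω => Muon.muon F W₀ η β (fun t i => ξ t i ω)) T with hJs
  have hJ1 : ∫ ω, Muon.avgJ f (Muon.muon F W₀ η β (fun t i => ξ t i ω)) T ∂P ≤ Js :=
    le_max_right _ _
  have hJ2 : ∫ ω, Muon.avgJhat f (Muon.muon F W₀ η β (fun t i => ξ t i ω)) T ∂P ≤ Js :=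
    le_max_left _ _
  have hβb : 0 ≤ β / (1 - β) := div_nonneg hβ0 hb.le
  -- The two curvature averages have nonnegative coefficients, so each expectation may be replaced
  -- by the maximum, whatever its sign.
  have k1 := mul_le_mul_of_nonneg_left (mul_le_mul_of_nonneg_left hJ1 hTpos.le)
    (by positivity : 0 ≤ η / 2)
  have k2 := mul_le_mul_of_nonneg_left (mul_le_mul_of_nonneg_left hJ2 hTpos.le)
    (by positivity : 0 ≤ 2 * (β / (1 - β)) * η)
  have k3 := mul_le_mul_of_nonneg_left hnoise (by positivity : 0 ≤ 2 * r)
  have hrpow : ((min m n : ℕ) : ℝ) ^ (3 / 2 : ℝ) = r ^ 3 := by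
    rw [hr, Real.sqrt_eq_rpow, ← Real.rpow_natCast, ← Real.rpow_mul (Nat.cast_nonneg _)]
    norm_num
  have e1 : √((min m n : ℕ) * (1 - β)) / √((1 + β) * B)
      = r * (√((1 - β) / (1 + β)) / √(B : ℝ)) := by
    rw [Real.sqrt_mul (Nat.cast_nonneg _), Real.sqrt_mul hb'.le, Real.sqrt_div hb.le]
    rw [div_div, ← mul_div_assoc]
  have hfinal := mul_le_mul_of_nonneg_left
    (hint.trans (add_le_add (add_le_add (add_le_add (add_le_add le_rfl k1) k2) le_rfl) k3))
    (by positivity : 0 ≤ 1 / (T : ℝ))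
  refine hfinal.trans_eq ?_
  rw [hrpow, mul_div_assoc (2 * σ), e1]
  have hsB : √(B : ℝ) ≠ 0 := (Real.sqrt_pos.2 hBpos).ne'
  field_simp
  ring
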